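/- Let $p$ be an odd prime, let $m\ge 2$, $n\ge 1$ and $1\le r\le \min\{n,m-1\}$ be integers, and let $$G=\langle x,y : x^{p^m}=1,\ y^{p^n}=1,\ yxy^{-1}=x^{1+p^{m-r}}\rangle .$$ Let $u$ be an integer that generates the group of units modulo $p^m$, and let $\alpha,\beta,\delta\in\mathrm{Aut}(G)$ be the automorphisms determined by $$\alpha(x)=x^u,\ \alpha(y)=y;\qquad \beta(x)=x,\ \beta(y)=x^{p^{\max\{m-n,0\}}}y;\qquad \delta(x)=x,\ \delta(y)=y^{1+p^r}.$$ Put $\widetilde\alpha=\alpha^{(p-1)p^{m-r-1}}$, $\widetilde\beta=\beta^{p^{\min\{m,n\}-r}}$, $\widetilde\delta=\delta^{p^{\max\{n-2r,0\}}}$ and $\widetilde u=u^{(p-1)p^{m-r-1}}$ (negative powers of $\widetilde u$ are taken modulo $p^m$). For $a,b,d\in\mathbb{Z}$, the triplet $(a,b,d)$ is called admissible if there is a map $\Gamma:G\to\mathrm{Aut}(G)$ with $\Gamma(x)=\widetilde\beta^{\,b}$, $\Gamma(y)=\widetilde\alpha^{\,a}\widetilde\delta^{\,d}$, $\Gamma(\sigma\tau)=\Gamma(\tau)\Gamma(\sigma)$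 and $\Gamma(\varphi(\sigma))=\varphi\Gamma(\sigma)\varphi^{-1}$ for all $\sigma,\tau\in G$ and $\varphi\in\mathrm{Aut}(G)$. Say that $(a,b,d)$ satisfies the isomorphism criterion if $$\widetilde u^{\,a}\bigl(1+(1-b)p^{m-r}\bigr)\not\equiv 1 \pmod{p^{m-r+1}}.$$ Let $\rho(\sigma)\in\mathrm{Perm}(G)$ be $\tau\mapsto\tau\sigma^{-1}$, let $\mathrm{Hol}(G)=\rho(G)\rtimes\mathrm{Aut}(G)\le\mathrm{Perm}(G)$, let $\mathrm{NHol}(G)$ be the normalizer of $\mathrm{Hol}(G)$ in $\mathrm{Perm}(G)$, and let $T(G)=\mathrm{NHol}(G)/\mathrm{Hol}(G)$. For $\ell\in\mathbb{Z}$ write $\pi_\ell(\sigma)=\sigma^\ell$. Suppose that either $m\le n$ and $r\le m-r$, or $n\le m-r$. Then: 1. There are exactly $(p-1)p^{r-1}$ residue classes modulo $\mathbb{M}=p^r\mathbb{Z}\times p^r\mathbb{Z}\times p^{\min\{r,n-r\}}\mathbb{Z}$ of admissible triplets $(a,b,0)$ that satisfy the isomorphism criterion. 2. Let $(a,b,0)$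 be any such triplet. There is a non-negative integer $j$ coprime to $p$ with $$\bigl(\widetilde u^{\,a}(1+(1-b)p^{m-r})\bigr)^{j}\equiv 1+p^{m-r}\pmod{p^m}.$$ For every such $j=j_{a,b,0}$, with $\Phi_x=\rho(x)\widetilde\beta^{\,b}$ and $\Phi_y=\rho(y)\widetilde\alpha^{\,a}$, there is a unique bijection $\pi_{a,b,0}:G\to G$ such that $\pi_{a,b,0}(x^iy^k)=(\Phi_x^{\,i}\Phi_y^{\,jk})(1)$ for all $i,k\in\mathbb{Z}$, and $$\pi_{a,b,0}\equiv\pi_{-j_{a,b,0}}\pmod{\mathrm{Aut}(G)},$$ that is, $\pi_{a,b,0}=\pi_{-j}\circ\varphi$ and $\pi_{a,b,0}=\varphi'\circ\pi_{-j}$ for some $\varphi,\varphi'\in\mathrm{Aut}(G)$. 3. If $n\le m-r$, then $\pi_\ell\in\mathrm{NHol}(G)$ for every integer $\ell$ coprime to $p$, and $$T(G)=\{\pi_\ell\,\mathrm{Hol}(G) : \ell\in\mathbb{Z}\text{ coprime to }p\}.$$ -/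

import Mathlib

namespace SplitMetacyclic

/-! ### The holomorph, the multiple holomorph and their quotient, for an arbitrary group -/

section Holomorph

/-- The right regular representation `ρ(σ) = (τ ↦ τ σ⁻¹)`. -/
def rho {H : Type*} [Group H] (σ : H) : Equiv.Perm H := Equiv.mulRight σ⁻¹

theorem rho_apply {H : Type*} [Group H] (σ τ : H) : rho σ τ = τ * σ⁻¹ := rfl

/-- An automorphism of `H`, viewed as a permutation of `H`. -/
def autPerm {H : Type*} [Group H] (φ : MulAut H) : Equiv.Perm H := MulAut.toPerm H φ

theorem autPerm_apply {H : Type*} [Group H] (φ : MulAut H) (τ : H) : autPerm φ τ = φ τ := rfl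

/-- The holomorph `Hol(H) = ρ(H) ⋊ Aut(H)`, as a subgroup of `Perm(H)`. -/
def holomorph (H : Type*) [Group H] : Subgroup (Equiv.Perm H) where
  carrier := {f | ∃ (σ : H) (φ : MulAut H), f = rho σ * autPerm φ}
  one_mem' := ⟨1, 1, by ext τ; simp [rho_apply, autPerm_apply]⟩
  mul_mem' := by
    rintro _ _ ⟨σ, φ, rfl⟩ ⟨σ', φ', rfl⟩
    exact ⟨σ * φ σ', φ * φ', by ext τ; simp [rho_apply, autPerm_apply, mul_assoc]⟩
  inv_mem' := by
    rintro _ ⟨σ, φ, rfl⟩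
    refine ⟨φ⁻¹ σ⁻¹, φ⁻¹, ?_⟩
    rw [inv_eq_iff_mul_eq_one]
    ext τ
    simp [rho_apply, autPerm_apply]

/-- The multiple holomorph `NHol(H)`: the normalizer of `Hol(H)` in `Perm(H)`. -/
def multipleHolomorph (H : Type*) [Group H] : Subgroup (Equiv.Perm H) :=
  Subgroup.normalizer (holomorph H : Set (Equiv.Perm H))

instance (H : Type*) [Group H] :
    ((holomorph H).subgroupOf (multipleHolomorph H)).Normal :=
  Subgroup.normal_in_normalizer

/-- The quotient group `T(H) = NHol(H) / Hol(H)`. -/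
abbrev T (H : Type*) [Group H] : Type _ :=
  multipleHolomorph H ⧸ (holomorph H).subgroupOf (multipleHolomorph H)

/-- The power map `π_ℓ : σ ↦ σ ^ ℓ`. -/
def powerMap (H : Type*) [Group H] (l : ℤ) : H → H := fun σ => σ ^ l

/-- `f` and `g` agree modulo `Aut(H)`, on either side: they have the same left coset
`f ∘ Aut(H) = g ∘ Aut(H)` and the same right coset `Aut(H) ∘ f = Aut(H) ∘ g`. -/
def EqModAut {H : Type*} [Group H] (f g : H → H) : Prop :=
  (∃ φ : MulAut H, f = g ∘ φ) ∧ (∃ φ : MulAut H, f = φ ∘ g)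

/-- `Γ` is an antihomomorphism from `H` to `Aut(H)`. -/
def IsAntihom {H : Type*} [Group H] (Γ : H → MulAut H) : Prop :=
  ∀ σ τ : H, Γ (σ * τ) = Γ τ * Γ σ

/-- `Γ` is `Aut(H)`-equivariant, with `Aut(H)` acting on itself by conjugation. -/
def IsAutEquivariant {H : Type*} [Group H] (Γ : H → MulAut H) : Prop :=
  ∀ (φ : MulAut H) (σ : H), Γ (φ σ) = φ * Γ σ * φ⁻¹

end Holomorph

/-! ### The group `G` -/

/-- The standing assumptions on the parameters of the presentation. -/
structure Params (p m n r : ℕ) : Prop where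
  prime : p.Prime
  odd : Odd p
  two_le_m : 2 ≤ m
  one_le_n : 1 ≤ n
  one_le_r : 1 ≤ r
  r_le : r ≤ min n (m - 1)

/-- The relators of the presentation
`⟨x, y : x ^ p ^ m = 1, y ^ p ^ n = 1, y x y⁻¹ = x ^ (1 + p ^ (m - r))⟩`. -/
def relators (p m n r : ℕ) : Set (FreeGroup (Fin 2)) :=
  {FreeGroup.of 0 ^ p ^ m, FreeGroup.of 1 ^ p ^ n,
    FreeGroup.of 1 * FreeGroup.of 0 * (FreeGroup.of 1)⁻¹ *
      (FreeGroup.of 0 ^ (1 + p ^ (m - r)))⁻¹}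

/-- The split metacyclic `p`-group `G`. -/
abbrev G (p m n r : ℕ) : Type := PresentedGroup (relators p m n r)

/-- The generator `x` of `G`. -/
def X (p m n r : ℕ) : G p m n r := PresentedGroup.of 0

/-- The generator `y` of `G`. -/
def Y (p m n r : ℕ) : G p m n r := PresentedGroup.of 1

section Presentation

variable {p m n r : ℕ}

theorem X_pow : X p m n r ^ p ^ m = 1 := by
  have h : PresentedGroup.mk (relators p m n r) (FreeGroup.of 0 ^ p ^ m) = 1 :=
    PresentedGroup.one_of_mem (by simp [relators])
  rwa [map_pow] at h

theorem Y_pow : Y p m n r ^ p ^ n = 1 := by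
  have h : PresentedGroup.mk (relators p m n r) (FreeGroup.of 1 ^ p ^ n) = 1 :=
    PresentedGroup.one_of_mem (by simp [relators])
  rwa [map_pow] at h

theorem Y_conj_X :
    Y p m n r * X p m n r * (Y p m n r)⁻¹ = X p m n r ^ (1 + p ^ (m - r)) := by
  have h : PresentedGroup.mk (relators p m n r)
      (FreeGroup.of 1 * FreeGroup.of 0 * (FreeGroup.of 1)⁻¹ *
        (FreeGroup.of 0 ^ (1 + p ^ (m - r)))⁻¹) = 1 :=
    PresentedGroup.one_of_mem (by simp [relators])
  rw [map_mul, map_inv, mul_inv_eq_one, map_mul, map_mul, map_inv, map_pow] at h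
  exact h

/-- The endomorphism of `G` with prescribed images of `x` and `y`. -/
def endo (a b : G p m n r) (h₁ : a ^ p ^ m = 1) (h₂ : b ^ p ^ n = 1)
    (h₃ : b * a * b⁻¹ = a ^ (1 + p ^ (m - r))) : G p m n r →* G p m n r :=
  PresentedGroup.toGroup (f := ![a, b]) (by
    intro w hw
    simp only [relators, Set.mem_insert_iff, Set.mem_singleton_iff] at hw
    rcases hw with rfl | rfl | rfl
    · simpa using h₁
    · simpa using h₂
    · simp [h₃])

theorem endo_X (a b : G p m n r) (h₁ h₂ h₃) : endo a b h₁ h₂ h₃ (X p m n r) = a := by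
  simp [endo, X]

theorem endo_Y (a b : G p m n r) (h₁ h₂ h₃) : endo a b h₁ h₂ h₃ (Y p m n r) = b := by
  simp [endo, Y]

theorem hom_ext {f g : G p m n r →* G p m n r} (hx : f (X p m n r) = g (X p m n r))
    (hy : f (Y p m n r) = g (Y p m n r)) : f = g := by
  apply PresentedGroup.ext
  intro i
  fin_cases i
  · exact hx
  · exact hy

/-- Two mutually inverse endomorphisms of `G` form an automorphism. -/
def autOfEndos (f g : G p m n r →* G p m n r)
    (h₁ : g (f (X p m n r)) = X p m n r) (h₂ : g (f (Y p m n r)) = Y p m n r)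
    (h₃ : f (g (X p m n r)) = X p m n r) (h₄ : f (g (Y p m n r)) = Y p m n r) :
    MulAut (G p m n r) :=
  MonoidHom.toMulEquiv f g (hom_ext h₁ h₂) (hom_ext h₃ h₄)

theorem autOfEndos_apply (f g : G p m n r →* G p m n r) (h₁ h₂ h₃ h₄) (σ : G p m n r) :
    autOfEndos f g h₁ h₂ h₃ h₄ σ = f σ := rfl

theorem Params.r_lt (h : Params p m n r) : r < m := by
  have h₁ := h.r_le
  have h₂ := h.two_le_m
  omega

theorem Params.r_le_n (h : Params p m n r) : r ≤ n := by
  have h₁ := h.r_le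
  omega

/-- If `p ^ s ∣ a - 1` with `1 ≤ s`, then `p ^ (s + j) ∣ a ^ p ^ j - 1`. -/
theorem dvd_pow_sub_one (p : ℕ) {s : ℕ} (hs : 1 ≤ s) (a : ℤ) (ha : (p : ℤ) ^ s ∣ a - 1) (j : ℕ) :
    (p : ℤ) ^ (s + j) ∣ a ^ p ^ j - 1 := by
  induction j with
  | zero => simpa using ha
  | succ j ih =>
    have hA : (p : ℤ) ∣ a ^ p ^ j - 1 := (dvd_pow_self _ (by omega)).trans ih
    rw [pow_succ p j, pow_mul, ← geom_sum_mul, ← add_assoc, pow_succ, mul_comm]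
    refine mul_dvd_mul ?_ ih
    have h1 : (a ^ p ^ j) ≡ 1 [ZMOD p] := (Int.modEq_iff_dvd.2 hA).symm
    have h2 : ∑ i ∈ Finset.range p, (a ^ p ^ j) ^ i ≡ ∑ i ∈ Finset.range p, 1 [ZMOD p] := by
      apply Int.ModEq.sum
      intro i _
      simpa using h1.pow i
    rw [Finset.sum_const, Finset.card_range, nsmul_eq_mul, mul_one] at h2
    exact Int.modEq_zero_iff_dvd.1 (h2.trans (by simp [Int.ModEq]))

theorem X_zpow_eq {i j : ℤ} (h : (p : ℤ) ^ m ∣ i - j) : X p m n r ^ i = X p m n r ^ j := by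
  obtain ⟨c, hc⟩ := h
  have : i = (p ^ m : ℕ) * c + j := by push_cast; linarith
  rw [this, zpow_add, zpow_mul, zpow_natCast, X_pow, one_zpow, one_mul]

theorem Y_zpow_eq {i j : ℤ} (h : (p : ℤ) ^ n ∣ i - j) : Y p m n r ^ i = Y p m n r ^ j := by
  obtain ⟨c, hc⟩ := h
  have : i = (p ^ n : ℕ) * c + j := by push_cast; linarith
  rw [this, zpow_add, zpow_mul, zpow_natCast, Y_pow, one_zpow, one_mul]

theorem Y_mul_X_zpow (i : ℤ) :
    Y p m n r * X p m n r ^ i = X p m n r ^ ((1 + p ^ (m - r) : ℤ) * i) * Y p m n r := by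
  rw [← mul_inv_eq_iff_eq_mul, ← conj_zpow, Y_conj_X, zpow_mul]
  norm_cast

theorem Y_pow_mul_X_zpow (l : ℕ) (i : ℤ) :
    Y p m n r ^ l * X p m n r ^ i =
      X p m n r ^ ((1 + p ^ (m - r) : ℤ) ^ l * i) * Y p m n r ^ l := by
  induction l with
  | zero => simp
  | succ l ih =>
    rw [pow_succ', mul_assoc, ih, ← mul_assoc, Y_mul_X_zpow, mul_assoc]
    ring_nf

theorem X_zpow_mul_Y_pow (c : ℤ) (l : ℕ) :
    (X p m n r ^ c * Y p m n r) ^ l =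
      X p m n r ^ (c * ∑ i ∈ Finset.range l, (1 + p ^ (m - r) : ℤ) ^ i) * Y p m n r ^ l := by
  induction l with
  | zero => simp
  | succ l ih =>
    rw [pow_succ, ih, mul_assoc, ← mul_assoc (Y p m n r ^ l), Y_pow_mul_X_zpow, pow_succ,
      Finset.sum_range_succ, mul_add, zpow_add, mul_comm c ((1 + p ^ (m - r) : ℤ) ^ l)]
    simp only [mul_assoc]

theorem pow_dvd_geom_sum (h : Params p m n r) :
    (p : ℤ) ^ n ∣ ∑ i ∈ Finset.range (p ^ n), (1 + p ^ (m - r) : ℤ) ^ i := by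
  have h1 := dvd_pow_sub_one p (s := m - r) (by have := h.r_lt; omega)
    (1 + p ^ (m - r) : ℤ) (by simp) n
  rw [← geom_sum_mul, add_sub_cancel_left, add_comm (m - r), pow_add] at h1
  have hp : (p : ℤ) ^ (m - r) ≠ 0 := pow_ne_zero _ (by exact_mod_cast h.prime.ne_zero)
  exact (mul_dvd_mul_iff_right hp).1 h1

theorem X_zpow_mul_Y_rel (h : Params p m n r) (c : ℤ) (hc : (p : ℤ) ^ m ∣ c * p ^ n) :
    (X p m n r ^ c * Y p m n r) ^ p ^ n = 1 := by
  rw [X_zpow_mul_Y_pow, Y_pow, mul_one]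
  have : X p m n r ^ (c * ∑ i ∈ Finset.range (p ^ n), (1 + p ^ (m - r) : ℤ) ^ i) =
      X p m n r ^ (0 : ℤ) := by
    apply X_zpow_eq
    rw [sub_zero]
    exact hc.trans (mul_dvd_mul_left c (pow_dvd_geom_sum h))
  rw [this, zpow_zero]

theorem Y_pow_rel (h : Params p m n r) (e : ℕ) (he : (p : ℤ) ^ r ∣ e - 1) (he' : 1 ≤ e) :
    Y p m n r ^ e * X p m n r * (Y p m n r ^ e)⁻¹ = X p m n r ^ (1 + p ^ (m - r)) := by
  have h1 := Y_pow_mul_X_zpow (p := p) (m := m) (n := n) (r := r) e 1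
  rw [zpow_one, mul_one] at h1
  rw [h1, mul_inv_cancel_right, ← zpow_natCast (X p m n r) (1 + p ^ (m - r))]
  apply X_zpow_eq
  push_cast
  obtain ⟨e, rfl⟩ := Nat.exists_eq_add_of_le' he'
  have h2 := dvd_pow_sub_one p (s := m - r) (by have := h.r_lt; omega)
    (1 + p ^ (m - r) : ℤ) (by simp) r
  rw [Nat.sub_add_cancel h.r_lt.le] at h2
  have h3 : p ^ r ∣ e := by
    have : (p : ℤ) ^ r ∣ (e : ℤ) := by simpa using he
    exact_mod_cast this
  obtain ⟨t, rfl⟩ := h3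
  have h4 : (p : ℤ) ^ m ∣ (1 + p ^ (m - r) : ℤ) ^ (p ^ r * t) - 1 := by
    rw [pow_mul]
    exact h2.trans (sub_one_dvd_pow_sub_one _ t)
  have h5 : (1 + p ^ (m - r) : ℤ) ^ (p ^ r * t + 1) - (1 + p ^ (m - r)) =
      ((1 + p ^ (m - r) : ℤ) ^ (p ^ r * t) - 1) * (1 + p ^ (m - r)) := by ring
  rw [h5]
  exact h4.mul_right _

end Presentation

/-! ### The automorphisms `α`, `β`, `δ` -/

section Automorphisms

variable {p m n r : ℕ}

/-- The endomorphism `x ↦ x ^ u`, `y ↦ y`. -/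
def alphaHom (u : (ZMod (p ^ m))ˣ) : G p m n r →* G p m n r :=
  endo (X p m n r ^ (u : ZMod (p ^ m)).val) (Y p m n r)
    (by rw [← pow_mul, mul_comm, pow_mul, X_pow, one_pow]) Y_pow
    (by rw [← conj_pow, Y_conj_X, ← pow_mul, ← pow_mul, mul_comm])

theorem X_pow_unit (h : Params p m n r) (u v : (ZMod (p ^ m))ˣ) (huv : u * v = 1) :
    (X p m n r ^ (u : ZMod (p ^ m)).val) ^ (v : ZMod (p ^ m)).val = X p m n r := by
  have : NeZero (p ^ m) := ⟨pow_ne_zero _ h.prime.ne_zero⟩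
  rw [← pow_mul]
  have h1 : (X p m n r) ^ ((u : ZMod (p ^ m)).val * (v : ZMod (p ^ m)).val : ℕ) =
      X p m n r ^ (1 : ℕ) := by
    rw [← zpow_natCast, ← zpow_natCast (X p m n r) 1]
    apply X_zpow_eq
    have h2 : (((u : ZMod (p ^ m)).val * (v : ZMod (p ^ m)).val : ℕ) : ZMod (p ^ m)) =
        ((1 : ℕ) : ZMod (p ^ m)) := by
      push_cast
      rw [ZMod.natCast_zmod_val, ZMod.natCast_zmod_val, ← Units.val_mul, huv, Units.val_one]
    rw [ZMod.natCast_eq_natCast_iff] at h2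
    have h3 := (Nat.modEq_iff_dvd.1 h2.symm)
    rwa [Nat.cast_pow] at h3
  rw [h1, pow_one]

/-- The automorphism `α`: `x ↦ x ^ u`, `y ↦ y`. -/
def alpha (h : Params p m n r) (u : (ZMod (p ^ m))ˣ) : MulAut (G p m n r) :=
  autOfEndos (alphaHom u) (alphaHom u⁻¹)
    (by simp only [alphaHom, endo_X, map_pow]
        rw [X_pow_unit h _ _ (inv_mul_cancel u)])
    (by simp only [alphaHom, endo_Y])
    (by simp only [alphaHom, endo_X, map_pow]
        rw [X_pow_unit h _ _ (mul_inv_cancel u)])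
    (by simp only [alphaHom, endo_Y])

theorem alpha_X (h : Params p m n r) (u : (ZMod (p ^ m))ˣ) :
    alpha h u (X p m n r) = X p m n r ^ (u : ZMod (p ^ m)).val := by
  simp only [alpha, autOfEndos_apply, alphaHom, endo_X]

theorem alpha_Y (h : Params p m n r) (u : (ZMod (p ^ m))ˣ) :
    alpha h u (Y p m n r) = Y p m n r := by
  simp only [alpha, autOfEndos_apply, alphaHom, endo_Y]

/-- The endomorphism `x ↦ x`, `y ↦ x ^ c y`. -/
def betaHom (h : Params p m n r) (c : ℤ) (hc : (p : ℤ) ^ m ∣ c * p ^ n) :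
    G p m n r →* G p m n r :=
  endo (X p m n r) (X p m n r ^ c * Y p m n r) X_pow (X_zpow_mul_Y_rel h c hc)
    (by
      have h1 : X p m n r ^ c * Y p m n r * X p m n r * (X p m n r ^ c * Y p m n r)⁻¹ =
          X p m n r ^ c * (Y p m n r * X p m n r * (Y p m n r)⁻¹) * (X p m n r ^ c)⁻¹ := by
        group
      rw [h1, Y_conj_X, ← zpow_natCast (X p m n r) (1 + p ^ (m - r)), ← zpow_neg, ← zpow_add,
        ← zpow_add]
      congr 1
      ring)

theorem beta_exponent (p m n : ℕ) : (p : ℤ) ^ m ∣ (p : ℤ) ^ (m - n) * p ^ n := by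
  rw [← pow_add]
  exact pow_dvd_pow _ (by omega)

/-- The automorphism `β`: `x ↦ x`, `y ↦ x ^ p ^ max{m - n, 0} y` (the subtraction in the code is
the truncated one). -/
def beta (h : Params p m n r) : MulAut (G p m n r) :=
  autOfEndos (betaHom h ((p : ℤ) ^ (m - n)) (beta_exponent p m n))
    (betaHom h (-(p : ℤ) ^ (m - n))
      (by rw [neg_mul]; exact (dvd_neg).2 (beta_exponent p m n)))
    (by simp only [betaHom, endo_X])
    (by simp only [betaHom, endo_X, endo_Y, map_mul, map_zpow]
        rw [← mul_assoc, ← zpow_add, add_neg_cancel, zpow_zero, one_mul])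
    (by simp only [betaHom, endo_X])
    (by simp only [betaHom, endo_X, endo_Y, map_mul, map_zpow]
        rw [← mul_assoc, ← zpow_add, neg_add_cancel, zpow_zero, one_mul])

theorem beta_X (h : Params p m n r) : beta h (X p m n r) = X p m n r := by
  simp only [beta, autOfEndos_apply, betaHom, endo_X]

theorem beta_Y (h : Params p m n r) :
    beta h (Y p m n r) = X p m n r ^ p ^ (m - n) * Y p m n r := by
  have h1 : beta h (Y p m n r) = X p m n r ^ ((p : ℤ) ^ (m - n)) * Y p m n r := by
    simp only [beta, autOfEndos_apply, betaHom, endo_Y]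
  rw [h1]
  norm_cast

/-- The endomorphism `x ↦ x`, `y ↦ y ^ e`, for `e ≡ 1` modulo `p ^ r`. -/
def deltaHom (h : Params p m n r) (e : ℕ) (he : (p : ℤ) ^ r ∣ e - 1) (he' : 1 ≤ e) :
    G p m n r →* G p m n r :=
  endo (X p m n r) (Y p m n r ^ e) X_pow
    (by rw [← pow_mul, mul_comm, pow_mul, Y_pow, one_pow]) (Y_pow_rel h e he he')

theorem Y_pow_delta (h : Params p m n r) : Y p m n r ^ (1 + p ^ r) ^ p ^ n = Y p m n r := by
  have h1 := dvd_pow_sub_one p h.one_le_r (1 + p ^ r : ℤ) (by simp) n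
  have h2 : (p : ℤ) ^ n ∣ (((1 + p ^ r) ^ p ^ n : ℕ) : ℤ) - 1 := by
    push_cast
    exact (pow_dvd_pow _ (by omega)).trans h1
  have h3 := Y_zpow_eq (m := m) (r := r) h2
  rwa [zpow_natCast, zpow_one] at h3

/-- The automorphism `δ`: `x ↦ x`, `y ↦ y ^ (1 + p ^ r)`. -/
def delta (h : Params p m n r) : MulAut (G p m n r) :=
  autOfEndos (deltaHom h (1 + p ^ r) (by simp) (by omega))
    (deltaHom h ((1 + p ^ r) ^ (p ^ n - 1))
      (by
        have h1 := sub_one_dvd_pow_sub_one (1 + (p : ℤ) ^ r) (p ^ n - 1)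
        rw [add_sub_cancel_left] at h1
        exact_mod_cast h1)
      (Nat.one_le_pow _ _ (by omega)))
    (by simp only [deltaHom, endo_X])
    (by simp only [deltaHom, endo_Y, map_pow]
        rw [← pow_mul, ← pow_succ, Nat.sub_add_cancel (Nat.one_le_pow _ _ h.prime.pos)]
        exact Y_pow_delta h)
    (by simp only [deltaHom, endo_X])
    (by simp only [deltaHom, endo_Y, map_pow]
        rw [← pow_mul, ← pow_succ', Nat.sub_add_cancel (Nat.one_le_pow _ _ h.prime.pos)]
        exact Y_pow_delta h)

theorem delta_X (h : Params p m n r) : delta h (X p m n r) = X p m n r := by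
  simp only [delta, autOfEndos_apply, deltaHom, endo_X]

theorem delta_Y (h : Params p m n r) :
    delta h (Y p m n r) = Y p m n r ^ (1 + p ^ r) := by
  simp only [delta, autOfEndos_apply, deltaHom, endo_Y]

/-- `α̃ = α ^ ((p - 1) p ^ (m - r - 1))`. -/
def alphaTilde (h : Params p m n r) (u : (ZMod (p ^ m))ˣ) : MulAut (G p m n r) :=
  alpha h u ^ ((p - 1) * p ^ (m - r - 1))

/-- `β̃ = β ^ p ^ (min{m, n} - r)`. -/
def betaTilde (h : Params p m n r) : MulAut (G p m n r) :=
  beta h ^ p ^ (min m n - r)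

/-- `δ̃ = δ ^ p ^ max{n - 2r, 0}` (the subtraction in the code is the truncated one). -/
def deltaTilde (h : Params p m n r) : MulAut (G p m n r) :=
  delta h ^ p ^ (n - 2 * r)

end Automorphisms

/-! ### Admissible triplets and the associated bijections -/

section Admissible

variable {p m n r : ℕ}

/-- The triplet `(a, b, d)` is admissible: the assignments `x ↦ β̃ ^ b`, `y ↦ α̃ ^ a δ̃ ^ d` extend
to an `Aut(G)`-equivariant antihomomorphism `Γ` from `G` to `Aut(G)`. -/
def Admissible (h : Params p m n r) (u : (ZMod (p ^ m))ˣ) (a b d : ℤ) : Prop :=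
  ∃ Γ : G p m n r → MulAut (G p m n r),
    Γ (X p m n r) = betaTilde h ^ b ∧
    Γ (Y p m n r) = alphaTilde h u ^ a * deltaTilde h ^ d ∧
    IsAntihom Γ ∧ IsAutEquivariant Γ

/-- The residue class of `ũ ^ a (1 + (1 - b) p ^ (m - r))` modulo `p ^ m`, where
`ũ = u ^ ((p - 1) p ^ (m - r - 1))`. -/
def isoBase (p m r : ℕ) (u : (ZMod (p ^ m))ˣ) (a b : ℤ) : ZMod (p ^ m) :=
  (((u ^ ((p - 1) * p ^ (m - r - 1))) ^ a : (ZMod (p ^ m))ˣ) : ZMod (p ^ m)) *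
    (1 + (1 - (b : ZMod (p ^ m))) * (p : ZMod (p ^ m)) ^ (m - r))

theorem Params.isoModulus_dvd (h : Params p m n r) : p ^ (m - r + 1) ∣ p ^ m :=
  pow_dvd_pow p (by have h₁ := h.r_lt; have h₂ := h.one_le_r; omega)

/-- The isomorphism criterion:
`ũ ^ a (1 + (1 - b) p ^ (m - r))` is not congruent to `1` modulo `p ^ (m - r + 1)`. -/
def IsoCriterion (h : Params p m n r) (u : (ZMod (p ^ m))ˣ) (a b : ℤ) : Prop :=
  ZMod.castHom h.isoModulus_dvd (ZMod (p ^ (m - r + 1))) (isoBase p m r u a b) ≠ 1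

/-- `j` is a possible choice of the exponent `j_{a,b,d}` of a triplet that satisfies the isomorphism
criterion: `j` is coprime to `p` and
`(ũ ^ a (1 + (1 - b) p ^ (m - r))) ^ j ≡ 1 + p ^ (m - r)` modulo `p ^ m`. -/
def IsExponent (p m r : ℕ) (u : (ZMod (p ^ m))ˣ) (a b : ℤ) (j : ℕ) : Prop :=
  j.Coprime p ∧ isoBase p m r u a b ^ j = 1 + (p : ZMod (p ^ m)) ^ (m - r)

/-- `Φ_x = ρ(x) β̃ ^ b`. -/
def PhiX (h : Params p m n r) (b : ℤ) : Equiv.Perm (G p m n r) :=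
  rho (X p m n r) * autPerm (betaTilde h ^ b)

/-- `Φ_y = ρ(y) α̃ ^ a δ̃ ^ d`. -/
def PhiY (h : Params p m n r) (u : (ZMod (p ^ m))ˣ) (a d : ℤ) : Equiv.Perm (G p m n r) :=
  rho (Y p m n r) * autPerm (alphaTilde h u ^ a * deltaTilde h ^ d)

/-- `π` is the bijection `π_{a,b,d}` attached to `(a, b, d)` and the choice `j` of the exponent
`j_{a,b,d}`: `π (x ^ i y ^ k) = (Φ_x ^ i Φ_y ^ (j k)) (1)` for all integers `i`, `k`. -/
def IsPi (h : Params p m n r) (u : (ZMod (p ^ m))ˣ) (a b d : ℤ) (j : ℕ)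
    (π : Equiv.Perm (G p m n r)) : Prop :=
  ∀ i k : ℤ, π (X p m n r ^ i * Y p m n r ^ k) =
    (PhiX h b ^ i * PhiY h u a d ^ ((j : ℤ) * k)) 1

/-- The residue classes modulo `p ^ r ℤ × p ^ r ℤ × p ^ min{r, n - r} ℤ` of the admissible triplets
`(a, b, 0)` that satisfy the isomorphism criterion. -/
def admissibleClasses (h : Params p m n r) (u : (ZMod (p ^ m))ˣ) :
    Set (ZMod (p ^ r) × ZMod (p ^ r) × ZMod (p ^ min r (n - r))) :=
  {t | ∃ a b : ℤ, Admissible h u a b 0 ∧ IsoCriterion h u a b ∧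
    t = ((a : ZMod (p ^ r)), (b : ZMod (p ^ r)), 0)}

end Admissible

end SplitMetacyclic

namespace SplitMetacyclic

/-! ### Power identities when a commutator is central -/

section ClassTwo

variable {H : Type*} [Group H] {s t z : H}

/-! Write q = p^(m-r). Both cases give r ≤ m - r, so q² = 0 modulo p^m and z = x^q is a central
commutator of order p^r. Thus G has class two, and products and powers are explicit in the normal
form x^i y^k, unique by `coord_eq_iff`.

Equivariance under β (if m ≤ n) or under γ : x ↦ xy (if n ≤ m - r) forces ũ^a (1 + bq) = 1 for an
admissible (a, b, 0). Conversely, that equation makes σ ↦ conj(σ^(-b)) a valid Γ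
(`unit_of_admissible`, `admissible_of_unit`). So b modulo p^r determines a, the base of the
criterion equals 1 + (1 - 2b)q, and the criterion says that p does not divide 1 - 2b. Counting such
b gives φ(p^r). The exponent j is an inverse of 1 - 2b modulo p^r, and a normal form computation
identifies π_{a,b,0} with the power map -j composed with the automorphism x ↦ x^(1/j) (`isPi_iff`).

For n ≤ m - r, an element π of NHol(G) fixing 1 yields an equivariant antihomomorphism Γ
(`exists_antihom_of_mem_multipleHolomorph`). Testing Γ against α, β, γ, δ shows Γ = conj(σ^(-b))
(`exists_eq_conj`), that is, π(στ) = π(τ)^b π(σ) π(τ)^(1-b). Bijectivity forces 1 - 2b to be prime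
to p (`isCoprime_of_twisted`), and the power map whose exponent l inverts 1 - 2b obeys the same law
(`mul_zpow_twisted`). Hence π is that power map composed with an automorphism. -/

theorem zpow_mul_zpow_of_commutator_central (hs : Commute z s) (ht : Commute z t)
    (h : s * t = z * (t * s)) (e f : ℤ) : s ^ e * t ^ f = z ^ (e * f) * (t ^ f * s ^ e) := by
  have h1 : s * t ^ f * s⁻¹ = z ^ f * t ^ f := by
    rw [← conj_zpow, h, ← ht.mul_zpow]
    group
  have h2 : (t ^ f)⁻¹ * s * t ^ f = z ^ f * s := by
    rw [mul_assoc, mul_inv_eq_iff_eq_mul.1 h1, ← mul_assoc, ← mul_assoc,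
      ((ht.zpow_zpow f f).inv_right).eq.symm]
    group
  have h3 : (t ^ f)⁻¹ * s ^ e * t ^ f = z ^ (e * f) * s ^ e := by
    have := conj_zpow (i := e) (a := (t ^ f)⁻¹) (b := s)
    rw [inv_inv] at this
    rw [← this, h2, (hs.zpow_left f).mul_zpow, ← zpow_mul, mul_comm f e]
  rw [mul_assoc, inv_mul_eq_iff_eq_mul] at h3
  rw [h3, ← mul_assoc, ← mul_assoc, (ht.zpow_zpow (e * f) f).eq]

theorem triangle_succ (l : ℤ) : (l + 1) * (l + 1 - 1) / 2 = l * (l - 1) / 2 + l := by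
  rw [show (l + 1) * (l + 1 - 1) = l * (l - 1) + l * 2 by ring,
    Int.add_mul_ediv_right _ _ two_ne_zero]

theorem two_mul_triangle (l : ℤ) : 2 * (l * (l - 1) / 2) = l * (l - 1) :=
  Int.mul_ediv_cancel' (Int.even_mul_pred_self l).two_dvd

theorem mul_zpow_of_commutator_central (hs : Commute z s) (ht : Commute z t)
    (h : s * t = z * (t * s)) (l : ℤ) :
    (s * t) ^ l = s ^ l * t ^ l * z ^ (-(l * (l - 1) / 2)) := by
  -- Moving the new s left past t^l costs z^(-l), the increment of the triangular number. As the
  -- identity holds for every integer l, it drives the induction in both directions.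
  have key : ∀ l : ℤ, s ^ (l + 1) * t ^ (l + 1) * z ^ (-((l + 1) * (l + 1 - 1) / 2)) =
      s ^ l * t ^ l * z ^ (-(l * (l - 1) / 2)) * (s * t) := by
    intro l
    have h1 := zpow_mul_zpow_of_commutator_central hs ht h 1 l
    rw [zpow_one, one_mul] at h1
    have h2 : t ^ l * s = z ^ (-l) * (s * t ^ l) := by
      rw [h1, ← mul_assoc, ← zpow_add, neg_add_cancel, zpow_zero, one_mul]
    have hzt := fun i : ℤ => (ht.zpow_left i).eq
    rw [triangle_succ, mul_assoc (s ^ l * t ^ l), (((hs.zpow_left _).mul_right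
      (ht.zpow_left _))).eq, ← mul_assoc, ← mul_assoc, mul_assoc (s ^ l) (t ^ l) s, h2,
      (hs.zpow_left (-l)).mul_right (ht.zpow_zpow (-l) l), zpow_add_one, zpow_add_one,
      neg_add, add_comm, zpow_add]
    simp only [mul_assoc]
    rw [← mul_assoc (z ^ (-l)) t, hzt]
    simp only [mul_assoc]
  induction l with
  | zero => simp
  | succ l ih => rw [key, zpow_add_one, ih]
  | pred l ih =>
    have := key (-l - 1)
    rw [sub_add_cancel, ← ih] at this
    rw [zpow_sub_one, this, mul_inv_cancel_right]

end ClassTwo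

/-! ### Normal form x^i y^k and its arithmetic -/

section Coordinates

variable {p m n r : ℕ}

/-- The action of `G` on `ℤ/p^m` by affine maps. -/
def affineAction (h : Params p m n r) : G p m n r →* Equiv.Perm (ZMod (p ^ m)) := by
  have hu : ((1 : ZMod (p ^ m)) + (p : ZMod (p ^ m)) ^ (m - r)) ^ p ^ n = 1 := by
    have h1 := dvd_pow_sub_one p (s := m - r) (by have := h.r_lt; omega)
      (1 + p ^ (m - r) : ℤ) (by simp) n
    have h2 : ((p ^ m : ℕ) : ℤ) ∣ (1 + p ^ (m - r) : ℤ) ^ p ^ n - 1 := by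
      push_cast
      exact (pow_dvd_pow _ (by have := h.r_lt; have := h.r_le_n; omega)).trans h1
    have h3 := (ZMod.intCast_zmod_eq_zero_iff_dvd _ _).2 h2
    push_cast at h3
    exact sub_eq_zero.1 h3
  have hn : p ^ n ≠ 0 := pow_ne_zero _ h.prime.ne_zero
  exact PresentedGroup.toGroup
    -- x acts as translation by 1 and y as multiplication by 1 + p^(m-r).
    (f := ![Equiv.addRight 1, MulAction.toPerm (Units.ofPowEqOne _ _ hu hn)]) (by
      intro w hw
      simp only [relators, Set.mem_insert_iff, Set.mem_singleton_iff] at hw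
      have hX : ∀ k : ℕ, (Equiv.addRight (1 : ZMod (p ^ m))) ^ k = Equiv.addRight (k : ZMod (p ^ m)) := by
        intro k
        ext t
        simp
      rcases hw with rfl | rfl | rfl
      · simp only [map_pow, FreeGroup.lift_apply_of, Matrix.cons_val_zero, hX]
        ext t
        simp
      · have h1 := map_pow (MulAction.toPermHom (ZMod (p ^ m))ˣ (ZMod (p ^ m)))
          (Units.ofPowEqOne _ _ hu hn) (p ^ n)
        rw [Units.pow_ofPowEqOne, map_one] at h1
        simpa using h1.symm
      · rw [map_mul, map_inv, mul_inv_eq_one]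
        simp only [map_mul, map_inv, map_pow, FreeGroup.lift_apply_of, Matrix.cons_val_zero, Matrix.cons_val_one, hX, mul_inv_eq_iff_eq_mul]
        ext t
        simp [Units.smul_def])

theorem affineAction_X (h : Params p m n r) (t : ZMod (p ^ m)) :
    affineAction h (X p m n r) t = t + 1 := by
  simp [affineAction, X]

theorem affineAction_X_zpow (h : Params p m n r) (i : ℤ) (t : ZMod (p ^ m)) :
    affineAction h (X p m n r ^ i) t = t + i := by
  have : affineAction h (X p m n r) = Equiv.addRight 1 := Equiv.ext (affineAction_X h)
  rw [map_zpow, this]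
  simp

theorem affineAction_Y_zpow_zero (h : Params p m n r) (k : ℤ) :
    affineAction h (Y p m n r ^ k) 0 = 0 := by
  rw [map_zpow]
  refine (Equiv.Perm.zpow_apply_eq_self_of_apply_eq_self ?_ k)
  simp [affineAction, Y]

/-- The exponent of `y`, as a homomorphism to `ℤ/p^n`. -/
def yExponent (p m n r : ℕ) : G p m n r →* Multiplicative (ZMod (p ^ n)) :=
  PresentedGroup.toGroup (f := ![1, Multiplicative.ofAdd 1]) (by
    intro w hw
    simp only [relators, Set.mem_insert_iff, Set.mem_singleton_iff] at hw
    rcases hw with rfl | rfl | rfl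
    · simp
    · simp [← ofAdd_nsmul]
    · simp)

theorem yExponent_eq (i k : ℤ) :
    yExponent p m n r (X p m n r ^ i * Y p m n r ^ k) =
      Multiplicative.ofAdd (k : ZMod (p ^ n)) := by
  simp [yExponent, X, Y, ← ofAdd_zsmul]

theorem X_zpow_congr {i j : ℤ} (h : (i : ZMod (p ^ m)) = j) :
    X p m n r ^ i = X p m n r ^ j := by
  apply X_zpow_eq
  have := (ZMod.intCast_eq_intCast_iff_dvd_sub _ _ _).1 h.symm
  exact_mod_cast this

theorem Y_zpow_congr {i j : ℤ} (h : (i : ZMod (p ^ n)) = j) :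
    Y p m n r ^ i = Y p m n r ^ j := by
  apply Y_zpow_eq
  have := (ZMod.intCast_eq_intCast_iff_dvd_sub _ _ _).1 h.symm
  exact_mod_cast this

/-- The presentation does not collapse: in the affine action y fixes 0, so the image of 0 reads off
i, while `yExponent` reads off k. -/
theorem coord_eq_iff (h : Params p m n r) {i k i' k' : ℤ} :
    X p m n r ^ i * Y p m n r ^ k = X p m n r ^ i' * Y p m n r ^ k' ↔
      (i : ZMod (p ^ m)) = i' ∧ (k : ZMod (p ^ n)) = k' := by
  constructor
  · intro H
    constructor
    · have := congrArg (fun σ => affineAction h σ 0) H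
      simpa only [map_mul, Equiv.Perm.mul_apply, affineAction_Y_zpow_zero, affineAction_X_zpow,
        zero_add] using this
    · have := congrArg (yExponent p m n r) H
      simpa [yExponent_eq] using this
  · rintro ⟨h1, h2⟩
    rw [X_zpow_congr h1, Y_zpow_congr h2]

theorem X_zpow_eq_iff (h : Params p m n r) {i j : ℤ} :
    X p m n r ^ i = X p m n r ^ j ↔ (i : ZMod (p ^ m)) = j := by
  simpa using coord_eq_iff h (i := i) (k := 0) (i' := j) (k' := 0)

/-- `x ^ p ^ (m - r)`, the commutator of `y` and `x`. -/
def Z (p m n r : ℕ) : G p m n r := X p m n r ^ ((p : ℤ) ^ (m - r))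

theorem Z_zpow (e : ℤ) : Z p m n r ^ e = X p m n r ^ ((p : ℤ) ^ (m - r) * e) := by
  rw [Z, ← zpow_mul]

theorem Z_zpow_eq_iff (h : Params p m n r) {i j : ℤ} :
    Z p m n r ^ i = Z p m n r ^ j ↔ (p : ℤ) ^ r ∣ i - j := by
  rw [Z_zpow, Z_zpow, X_zpow_eq_iff h, eq_comm, ZMod.intCast_eq_intCast_iff_dvd_sub, ← mul_sub]
  have h1 : ((p ^ m : ℕ) : ℤ) = (p : ℤ) ^ (m - r) * p ^ r := by
    rw [← pow_add, Nat.sub_add_cancel h.r_lt.le]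
    push_cast
    rfl
  rw [h1, mul_dvd_mul_iff_left]
  exact pow_ne_zero _ (by exact_mod_cast h.prime.ne_zero)

theorem Z_zpow_eq_one_iff (h : Params p m n r) {i : ℤ} :
    Z p m n r ^ i = 1 ↔ (p : ℤ) ^ r ∣ i := by
  simpa using Z_zpow_eq_iff h (i := i) (j := 0)

theorem Y_mul_X : Y p m n r * X p m n r = Z p m n r * (X p m n r * Y p m n r) := by
  have := Y_mul_X_zpow (p := p) (m := m) (n := n) (r := r) 1
  rw [zpow_one] at this
  rw [this, mul_one, add_comm, zpow_add, zpow_one, Z, mul_assoc]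

theorem commute_Z_X : Commute (Z p m n r) (X p m n r) := (Commute.refl _).zpow_left _

/-- This is how r ≤ m - r acts: it makes z central and makes the factors 1 + cq multiply by adding
the c. -/
theorem sq_eq_zero (hr : r ≤ m - r) : ((p : ZMod (p ^ m)) ^ (m - r)) ^ 2 = 0 := by
  rw [← pow_mul]
  have : ((p ^ ((m - r) * 2) : ℕ) : ZMod (p ^ m)) = 0 :=
    (ZMod.natCast_eq_zero_iff _ _).2 (pow_dvd_pow _ (by omega))
  exact_mod_cast this

theorem commute_Z_Y (hr : r ≤ m - r) : Commute (Z p m n r) (Y p m n r) := by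
  rw [Commute, SemiconjBy, Z, Y_mul_X_zpow]
  congr 1
  apply X_zpow_congr
  push_cast
  linear_combination -sq_eq_zero (p := p) hr

theorem Y_zpow_mul_X_zpow (hr : r ≤ m - r) (k i : ℤ) :
    Y p m n r ^ k * X p m n r ^ i = Z p m n r ^ (k * i) * (X p m n r ^ i * Y p m n r ^ k) :=
  zpow_mul_zpow_of_commutator_central (commute_Z_Y hr) commute_Z_X Y_mul_X k i

theorem coord_mul (hr : r ≤ m - r) (i k i' k' : ℤ) :
    X p m n r ^ i * Y p m n r ^ k * (X p m n r ^ i' * Y p m n r ^ k') =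
      X p m n r ^ (i + i' + (p : ℤ) ^ (m - r) * (k * i')) * Y p m n r ^ (k + k') := by
  rw [mul_assoc, ← mul_assoc (Y p m n r ^ k), Y_zpow_mul_X_zpow hr, Z_zpow, zpow_add, zpow_add,
    zpow_add]
  simp only [← mul_assoc]
  rw [mul_assoc (X p m n r ^ i), ← zpow_add, add_comm, zpow_add]
  simp only [← mul_assoc]

theorem exists_coord (hr : r ≤ m - r) (σ : G p m n r) :
    ∃ i k : ℤ, σ = X p m n r ^ i * Y p m n r ^ k := by
  induction σ using PresentedGroup.induction_on with
  | H w =>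
  induction w using FreeGroup.induction_on with
  | C1 => exact ⟨0, 0, by simp⟩
  | of g =>
    fin_cases g
    · exact ⟨1, 0, by simp [X, PresentedGroup.of]⟩
    · exact ⟨0, 1, by simp [Y, PresentedGroup.of]⟩
  | inv_of g _ =>
    fin_cases g
    · exact ⟨-1, 0, by simp [X, PresentedGroup.of]⟩
    · exact ⟨0, -1, by simp [Y, PresentedGroup.of]⟩
  | mul a b ha hb =>
    obtain ⟨i, k, ha⟩ := ha
    obtain ⟨i', k', hb⟩ := hb
    exact ⟨_, _, by rw [map_mul, ha, hb, coord_mul hr]⟩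

theorem commute_Z (hr : r ≤ m - r) (σ : G p m n r) : Commute (Z p m n r) σ := by
  obtain ⟨i, k, rfl⟩ := exists_coord hr σ
  exact (commute_Z_X.zpow_right i).mul_right ((commute_Z_Y hr).zpow_right k)

theorem exists_commutator (hr : r ≤ m - r) (σ τ : G p m n r) :
    ∃ w : ℤ, σ * τ = Z p m n r ^ w * (τ * σ) := by
  obtain ⟨i, k, rfl⟩ := exists_coord hr σ
  obtain ⟨i', k', rfl⟩ := exists_coord hr τ
  refine ⟨k * i' - k' * i, ?_⟩
  rw [coord_mul hr, coord_mul hr, Z_zpow, ← mul_assoc (X p m n r ^ _), ← zpow_add, add_comm k']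
  congr 2
  ring

theorem exists_zpow_commutator (hr : r ≤ m - r) (σ τ : G p m n r) :
    ∃ w : ℤ, ∀ e f : ℤ, σ ^ e * τ ^ f = Z p m n r ^ (w * (e * f)) * (τ ^ f * σ ^ e) := by
  obtain ⟨w, hw⟩ := exists_commutator hr σ τ
  refine ⟨w, fun e f => ?_⟩
  rw [zpow_mul]
  exact zpow_mul_zpow_of_commutator_central ((commute_Z hr σ).zpow_left w)
    ((commute_Z hr τ).zpow_left w) hw e f

theorem mul_zpow_eq (hr : r ≤ m - r) {σ τ : G p m n r} {w : ℤ}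
    (hw : σ * τ = Z p m n r ^ w * (τ * σ)) (l : ℤ) :
    (σ * τ) ^ l = Z p m n r ^ (-(w * (l * (l - 1) / 2))) * (σ ^ l * τ ^ l) := by
  rw [mul_zpow_of_commutator_central ((commute_Z hr σ).zpow_left w)
    ((commute_Z hr τ).zpow_left w) hw, ← zpow_mul, mul_neg, ((commute_Z hr _).zpow_left _).eq]

theorem coord_zpow (hr : r ≤ m - r) (i k l : ℤ) :
    (X p m n r ^ i * Y p m n r ^ k) ^ l =
      X p m n r ^ (i * l + (p : ℤ) ^ (m - r) * (i * k * (l * (l - 1) / 2))) *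
        Y p m n r ^ (k * l) := by
  have h1 : X p m n r ^ i * Y p m n r ^ k =
      Z p m n r ^ (-(k * i)) * (Y p m n r ^ k * X p m n r ^ i) := by
    rw [Y_zpow_mul_X_zpow hr, ← mul_assoc, ← zpow_add, neg_add_cancel, zpow_zero, one_mul]
  rw [mul_zpow_eq hr h1, Z_zpow, ← zpow_mul, ← zpow_mul, ← mul_assoc, ← zpow_add]
  congr 2
  ring

end Coordinates

/-! ### Inner automorphisms and antihomomorphisms -/

section Conjugation

variable {p m n r : ℕ}

theorem mulAut_ext {φ ψ : MulAut (G p m n r)} (hx : φ (X p m n r) = ψ (X p m n r))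
    (hy : φ (Y p m n r) = ψ (Y p m n r)) : φ = ψ := by
  have := hom_ext (f := φ.toMonoidHom) (g := ψ.toMonoidHom) hx hy
  ext σ
  exact DFunLike.congr_fun this σ

theorem conj_X_zpow_X (e : ℤ) : MulAut.conj (X p m n r ^ e) (X p m n r) = X p m n r := by
  rw [MulAut.conj_apply, ((Commute.refl (X p m n r)).zpow_left e).eq, mul_inv_cancel_right]

theorem conj_Y_zpow_Y (e : ℤ) : MulAut.conj (Y p m n r ^ e) (Y p m n r) = Y p m n r := by
  rw [MulAut.conj_apply, ((Commute.refl (Y p m n r)).zpow_left e).eq, mul_inv_cancel_right]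

theorem conj_Y_zpow_X (hr : r ≤ m - r) (e : ℤ) :
    MulAut.conj (Y p m n r ^ e) (X p m n r) = Z p m n r ^ e * X p m n r := by
  have := Y_zpow_mul_X_zpow (p := p) (n := n) hr e 1
  rw [zpow_one, mul_one] at this
  rw [MulAut.conj_apply, this, ← mul_assoc, mul_inv_cancel_right]

theorem conj_X_zpow_Y (hr : r ≤ m - r) (e : ℤ) :
    MulAut.conj (X p m n r ^ e) (Y p m n r) = Z p m n r ^ (-e) * Y p m n r := by
  have := Y_zpow_mul_X_zpow (p := p) (n := n) hr 1 e
  rw [zpow_one, one_mul] at this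
  rw [MulAut.conj_apply, mul_inv_eq_iff_eq_mul, mul_assoc, this, ← mul_assoc, ← zpow_add,
    neg_add_cancel, zpow_zero, one_mul]

theorem conj_Z_zpow (hr : r ≤ m - r) (e : ℤ) : MulAut.conj (Z p m n r ^ e) = 1 := by
  ext σ
  rw [MulAut.conj_apply, ((commute_Z hr σ).zpow_left e).eq, mul_inv_cancel_right]
  rfl

/-- Modulo the central powers of z, (στ)^e equals τ^e σ^e, and conjugation does not see these
powers. -/
theorem isAntihom_conj_zpow (hr : r ≤ m - r) (e : ℤ) :
    IsAntihom fun σ : G p m n r => MulAut.conj (σ ^ e) := by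
  intro σ τ
  obtain ⟨w, hw⟩ := exists_zpow_commutator hr σ τ
  have h1 := hw 1 1
  rw [zpow_one, zpow_one] at h1
  simp only
  rw [mul_zpow_eq hr h1, hw, ← mul_assoc, ← zpow_add, map_mul, conj_Z_zpow hr, one_mul, map_mul]

theorem isAutEquivariant_conj_zpow {H : Type*} [Group H] (e : ℤ) :
    IsAutEquivariant fun σ : H => MulAut.conj (σ ^ e) := by
  intro φ σ
  ext τ
  simp only [MulAut.mul_apply, MulAut.conj_apply, MulAut.inv_apply, map_mul, map_inv,
    ← map_zpow φ σ e, MulEquiv.apply_symm_apply]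

/-- An antihomomorphism is a homomorphism to the opposite group, so the generators determine it. -/
theorem IsAntihom.ext {A : Type*} [Group A] {Γ Γ' : G p m n r → A}
    (hΓ : ∀ σ τ, Γ (σ * τ) = Γ τ * Γ σ) (hΓ' : ∀ σ τ, Γ' (σ * τ) = Γ' τ * Γ' σ)
    (hx : Γ (X p m n r) = Γ' (X p m n r)) (hy : Γ (Y p m n r) = Γ' (Y p m n r)) : Γ = Γ' := by
  let f : G p m n r →* Aᵐᵒᵖ := MonoidHom.mk' (fun σ => MulOpposite.op (Γ σ)) fun σ τ => by
    simp [hΓ]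
  let g : G p m n r →* Aᵐᵒᵖ := MonoidHom.mk' (fun σ => MulOpposite.op (Γ' σ)) fun σ τ => by
    simp [hΓ']
  have : f = g := by
    apply PresentedGroup.ext
    intro i
    fin_cases i
    · exact congrArg MulOpposite.op hx
    · exact congrArg MulOpposite.op hy
  funext σ
  exact MulOpposite.op_injective (DFunLike.congr_fun this σ)

end Conjugation

/-! ### Powers of α and β as inner automorphisms; the automorphism γ -/

section Automorphisms

variable {p m n r : ℕ}

theorem alpha_mul (h : Params p m n r) (u v : (ZMod (p ^ m))ˣ) :
    alpha h (u * v) = alpha h u * alpha h v := by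
  have : NeZero (p ^ m) := ⟨pow_ne_zero _ h.prime.ne_zero⟩
  apply mulAut_ext
  · rw [MulAut.mul_apply, alpha_X, alpha_X, map_pow, alpha_X, ← pow_mul, ← zpow_natCast,
      ← zpow_natCast]
    apply X_zpow_congr
    push_cast
    simp
  · simp [alpha_Y]

theorem alpha_zpow (h : Params p m n r) (u : (ZMod (p ^ m))ˣ) (a : ℤ) :
    alpha h u ^ a = alpha h (u ^ a) :=
  (map_zpow (MonoidHom.mk' (alpha h) (alpha_mul h)) u a).symm

theorem alpha_X_eq (h : Params p m n r) (u : (ZMod (p ^ m))ˣ) {v : ℤ}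
    (hv : (v : ZMod (p ^ m)) = u) : alpha h u (X p m n r) = X p m n r ^ v := by
  have : NeZero (p ^ m) := ⟨pow_ne_zero _ h.prime.ne_zero⟩
  rw [alpha_X, ← zpow_natCast]
  apply X_zpow_congr
  simp [hv]

theorem alphaTilde_zpow (h : Params p m n r) (u : (ZMod (p ^ m))ˣ) (a : ℤ) :
    alphaTilde h u ^ a = alpha h ((u ^ ((p - 1) * p ^ (m - r - 1))) ^ a) := by
  rw [alphaTilde, ← zpow_natCast, alpha_zpow, alpha_zpow, zpow_natCast]

theorem zpow_apply_Y {φ : MulAut (G p m n r)} {c : ℤ} (hx : φ (X p m n r) = X p m n r)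
    (hy : φ (Y p m n r) = X p m n r ^ c * Y p m n r) (k : ℤ) :
    (φ ^ k) (X p m n r) = X p m n r ∧ (φ ^ k) (Y p m n r) = X p m n r ^ (c * k) * Y p m n r := by
  have key : ∀ k : ℤ, φ (X p m n r ^ (c * k) * Y p m n r) =
      X p m n r ^ (c * (k + 1)) * Y p m n r := by
    intro k
    rw [map_mul, map_zpow, hx, hy, ← mul_assoc, ← zpow_add]
    ring_nf
  have hi : φ⁻¹ (X p m n r) = X p m n r := by
    rw [MulAut.inv_apply, MulEquiv.symm_apply_eq, hx]
  induction k with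
  | zero => simp
  | succ k ih => rw [add_comm, zpow_one_add, MulAut.mul_apply, MulAut.mul_apply, ih.1, ih.2, key,
      hx, add_comm]; simp
  | pred k ih =>
    rw [sub_eq_neg_add, zpow_add, zpow_neg_one, MulAut.mul_apply, MulAut.mul_apply, ih.1, ih.2,
      hi, MulAut.inv_apply, MulEquiv.symm_apply_eq, key]
    simp

theorem betaTilde_zpow (h : Params p m n r) (b : ℤ) :
    (betaTilde h ^ b) (X p m n r) = X p m n r ∧
      (betaTilde h ^ b) (Y p m n r) = Z p m n r ^ b * Y p m n r := by
  have h1 := zpow_apply_Y (beta_X h) (c := (p : ℤ) ^ (m - n)) (by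
    rw [beta_Y, ← zpow_natCast]; push_cast; rfl) ((p ^ (min m n - r) : ℕ) * b)
  rw [zpow_mul, zpow_natCast] at h1
  have h2 : (p : ℤ) ^ (m - n) * ((p ^ (min m n - r) : ℕ) * b) = (p : ℤ) ^ (m - r) * b := by
    rw [← mul_assoc]
    push_cast
    rw [← pow_add]
    congr 2
    have := h.r_lt; have := h.r_le_n
    omega
  rwa [h2, ← Z_zpow] at h1

theorem betaTilde_zpow_eq_conj (h : Params p m n r) (hr : r ≤ m - r) (b : ℤ) :
    betaTilde h ^ b = MulAut.conj (X p m n r ^ (-b)) := by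
  apply mulAut_ext
  · rw [(betaTilde_zpow h b).1, conj_X_zpow_X]
  · rw [(betaTilde_zpow h b).2, conj_X_zpow_Y hr, neg_neg]

/-- Since q² = 0, the inverse of 1 + qb is 1 - qb, the factor by which y^(-b) acts on exponents of
x. -/
theorem alpha_eq_conj (h : Params p m n r) (hr : r ≤ m - r) (v : (ZMod (p ^ m))ˣ) {b : ℤ}
    (hv : (v : ZMod (p ^ m)) * (1 + (p : ZMod (p ^ m)) ^ (m - r) * b) = 1) :
    alpha h v = MulAut.conj (Y p m n r ^ (-b)) := by
  apply mulAut_ext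
  · rw [conj_Y_zpow_X hr, Z_zpow, ← zpow_add_one]
    apply alpha_X_eq
    push_cast
    linear_combination (-1 + (p : ZMod (p ^ m)) ^ (m - r) * b) * hv +
       (- v * b ^ 2 : ZMod (p ^ m)) * sq_eq_zero (p := p) hr
  · rw [alpha_Y, conj_Y_zpow_Y]

theorem triangle_odd_mul {q : ℤ} (hq : Odd q) : q * (q - 1) / 2 = q * ((q - 1) / 2) :=
  Int.mul_ediv_assoc _ (by obtain ⟨k, rfl⟩ := hq; simp)

theorem Params.odd_pow (h : Params p m n r) (k : ℕ) : Odd ((p : ℤ) ^ k) :=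
  ((Int.odd_coe_nat p).2 h.odd).pow

/-- As p is odd, p^N divides the triangular number p^N (p^N - 1)/2, so the correction by a power of
z vanishes. -/
theorem coord_zpow_of_dvd (h : Params p m n r) (hr : r ≤ m - r) {N : ℕ} (hN : r ≤ N) (i k : ℤ) :
    (X p m n r ^ i * Y p m n r ^ k) ^ ((p : ℤ) ^ N) =
      X p m n r ^ (i * p ^ N) * Y p m n r ^ (k * p ^ N) := by
  rw [coord_zpow hr]
  congr 1
  apply X_zpow_eq
  rw [triangle_odd_mul (h.odd_pow N), add_sub_cancel_left]
  have : (p : ℤ) ^ m ∣ p ^ (m - r) * p ^ N := by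
    rw [← pow_add]
    exact pow_dvd_pow _ (by omega)
  refine this.trans ⟨i * k * ((p ^ N - 1) / 2), by ring⟩

/-- For `n ≤ m - r`, the endomorphism `x ↦ x y ^ e`, `y ↦ y`. -/
def gammaHom (h : Params p m n r) (hr : r ≤ m - r) (hn : n ≤ m - r) (e : ℤ) :
    G p m n r →* G p m n r :=
  endo (X p m n r * Y p m n r ^ e) (Y p m n r)
    (by
      have h1 := coord_zpow_of_dvd h hr h.r_lt.le 1 e
      rw [zpow_one, ← Nat.cast_pow, zpow_natCast] at h1
      rw [h1, one_mul, zpow_natCast, X_pow, one_mul, ← zpow_zero (Y p m n r)]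
      apply Y_zpow_eq
      push_cast
      rw [sub_zero]
      exact (pow_dvd_pow _ (by omega)).mul_left e)
    Y_pow
    (by
      have h1 := coord_zpow_of_dvd h hr hr 1 e
      -- Here n ≤ m - r matters: x y^e and x have the same p^(m-r)-th power z.
      have h2 : Y p m n r ^ (e * (p : ℤ) ^ (m - r)) = 1 := by
        rw [← zpow_zero (Y p m n r)]
        apply Y_zpow_eq
        rw [sub_zero]
        exact (pow_dvd_pow _ hn).mul_left e
      rw [h2, one_mul, mul_one, zpow_one] at h1
      rw [pow_add, pow_one, ← zpow_natCast _ (p ^ (m - r))]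
      push_cast
      rw [h1, mul_inv_eq_iff_eq_mul, ← mul_assoc, Y_mul_X, ← Z, ((commute_Z hr _).symm).eq]
      simp only [mul_assoc]
      rw [(Commute.refl (Y p m n r)).zpow_right e])

/-- For `n ≤ m - r`, the automorphism `x ↦ x y`, `y ↦ y`. -/
def gamma (h : Params p m n r) (hr : r ≤ m - r) (hn : n ≤ m - r) : MulAut (G p m n r) :=
  autOfEndos (gammaHom h hr hn 1) (gammaHom h hr hn (-1))
    (by simp [gammaHom, endo_X, endo_Y])
    (by simp [gammaHom, endo_Y])
    (by simp [gammaHom, endo_X, endo_Y])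
    (by simp [gammaHom, endo_Y])

theorem gamma_X (h : Params p m n r) (hr : r ≤ m - r) (hn : n ≤ m - r) :
    gamma h hr hn (X p m n r) = X p m n r * Y p m n r := by
  simp only [gamma, autOfEndos_apply, gammaHom, endo_X, zpow_one]

end Automorphisms

/-! ### Admissibility, the criterion and the exponent in terms of b -/

section Equivariant

variable {p m n r : ℕ}

/-- For m ≤ n one has β(y) = xy, so Γ(y)Γ(x)β = βΓ(y); evaluating at y and comparing exponents of x
gives the equation. -/
theorem unit_of_beta_equivariant (h : Params p m n r) {Γ : G p m n r → MulAut (G p m n r)}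
    (hΓ : IsAntihom Γ) (hΓ' : IsAutEquivariant Γ) (hmn : m ≤ n) {a b : ℤ}
    (hxx : Γ (X p m n r) (X p m n r) = X p m n r)
    (hxy : Γ (X p m n r) (Y p m n r) = Z p m n r ^ b * Y p m n r)
    (hyx : Γ (Y p m n r) (X p m n r) = X p m n r ^ a)
    (hyy : Γ (Y p m n r) (Y p m n r) = Y p m n r) :
    (a : ZMod (p ^ m)) * (1 + (p : ZMod (p ^ m)) ^ (m - r) * b) = 1 := by
  have hβ : beta h (Y p m n r) = X p m n r * Y p m n r := by
    rw [beta_Y, Nat.sub_eq_zero_of_le hmn, pow_zero, pow_one]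
  have h1 := hΓ' (beta h) (Y p m n r)
  rw [hβ, hΓ, eq_mul_inv_iff_mul_eq] at h1
  have h2 := DFunLike.congr_fun h1 (Y p m n r)
  simp only [MulAut.mul_apply, map_mul, map_zpow, hβ, hxx, hxy, hyx, hyy, Z_zpow] at h2
  rw [← mul_assoc, mul_left_inj, ← zpow_mul, ← zpow_add] at h2
  have h3 := (X_zpow_eq_iff h (j := 1)).1 (h2.trans (zpow_one _).symm)
  push_cast at h3
  linear_combination h3

/-- The same argument with γ(x) = xy: evaluate Γ(y)Γ(x)γ = γΓ(x) at x. Here Γ(y) may also raise y to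
a power d, which the y-coordinate forces to be trivial. -/
theorem unit_of_gamma_equivariant (h : Params p m n r) (hr : r ≤ m - r)
    {Γ : G p m n r → MulAut (G p m n r)}
    (hΓ : IsAntihom Γ) (hΓ' : IsAutEquivariant Γ) (hmn : n ≤ m - r) {a b d : ℤ}
    (hxx : Γ (X p m n r) (X p m n r) = X p m n r)
    (hxy : Γ (X p m n r) (Y p m n r) = Z p m n r ^ b * Y p m n r)
    (hyx : Γ (Y p m n r) (X p m n r) = X p m n r ^ a)
    (hyy : Γ (Y p m n r) (Y p m n r) = Y p m n r ^ d) :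
    (a : ZMod (p ^ m)) * (1 + (p : ZMod (p ^ m)) ^ (m - r) * b) = 1 ∧ (d : ZMod (p ^ n)) = 1 := by
  have h1 := hΓ' (gamma h hr hmn) (X p m n r)
  rw [gamma_X, hΓ, eq_mul_inv_iff_mul_eq] at h1
  have h2 := DFunLike.congr_fun h1 (X p m n r)
  simp only [MulAut.mul_apply, map_mul, map_zpow, gamma_X, hxx, hxy, hyx, hyy, Z_zpow] at h2
  rw [← mul_assoc, ← zpow_mul, ← zpow_add] at h2
  have h3 := (coord_eq_iff h (i' := 1) (k' := 1)).1 (h2.trans (by rw [zpow_one, zpow_one]))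
  push_cast at h3
  exact ⟨by linear_combination h3.1, h3.2⟩

theorem unit_of_admissible (h : Params p m n r) (hr : r ≤ m - r) (u : (ZMod (p ^ m))ˣ)
    (hcase : m ≤ n ∨ n ≤ m - r) {a b : ℤ} (hab : Admissible h u a b 0) :
    (((u ^ ((p - 1) * p ^ (m - r - 1))) ^ a : (ZMod (p ^ m))ˣ) : ZMod (p ^ m)) *
      (1 + (p : ZMod (p ^ m)) ^ (m - r) * b) = 1 := by
  obtain ⟨Γ, hx, hy, hΓ, hΓ'⟩ := hab
  rw [zpow_zero, mul_one, alphaTilde_zpow] at hy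
  obtain ⟨hxx, hxy⟩ := betaTilde_zpow h b
  rw [← hx] at hxx hxy
  obtain ⟨v, hv⟩ := ZMod.intCast_surjective
    (((u ^ ((p - 1) * p ^ (m - r - 1))) ^ a : (ZMod (p ^ m))ˣ) : ZMod (p ^ m))
  have hyx := alpha_X_eq h _ hv
  have hyy := alpha_Y h ((u ^ ((p - 1) * p ^ (m - r - 1))) ^ a)
  rw [← hy] at hyx hyy
  rw [← hv]
  rcases hcase with hmn | hmn
  · exact unit_of_beta_equivariant h hΓ hΓ' hmn hxx hxy hyx hyy
  · exact (unit_of_gamma_equivariant h hr hΓ hΓ' hmn (d := 1) hxx hxy hyx (by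
      rw [zpow_one]; exact hyy)).1

theorem admissible_of_unit (h : Params p m n r) (hr : r ≤ m - r) (u : (ZMod (p ^ m))ˣ)
    {a b : ℤ}
    (hab : (((u ^ ((p - 1) * p ^ (m - r - 1))) ^ a : (ZMod (p ^ m))ˣ) : ZMod (p ^ m)) *
      (1 + (p : ZMod (p ^ m)) ^ (m - r) * b) = 1) : Admissible h u a b 0 := by
  refine ⟨fun σ => MulAut.conj (σ ^ (-b)), (betaTilde_zpow_eq_conj h hr b).symm, ?_,
    isAntihom_conj_zpow hr _, isAutEquivariant_conj_zpow _⟩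
  rw [zpow_zero, mul_one, alphaTilde_zpow]
  exact (alpha_eq_conj h hr _ hab).symm

/-- The hypothesis says ũ^a = 1 - bq, and (1 - bq)(1 + (1 - b)q) is linear in q because q² = 0. -/
theorem isoBase_eq (hr : r ≤ m - r) {u : (ZMod (p ^ m))ˣ} {a b : ℤ}
    (hab : (((u ^ ((p - 1) * p ^ (m - r - 1))) ^ a : (ZMod (p ^ m))ˣ) : ZMod (p ^ m)) *
      (1 + (p : ZMod (p ^ m)) ^ (m - r) * b) = 1) :
    isoBase p m r u a b = 1 + (1 - 2 * b) * (p : ZMod (p ^ m)) ^ (m - r) := by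
  have hq := sq_eq_zero (p := p) hr
  rw [isoBase]
  set v := (((u ^ ((p - 1) * p ^ (m - r - 1))) ^ a : (ZMod (p ^ m))ˣ) : ZMod (p ^ m))
  set q := (p : ZMod (p ^ m)) ^ (m - r)
  linear_combination (1 + (1 - 2 * b) * q) * hab - v * (b * (1 - 2 * b)) * hq

theorem isoCriterion_iff (h : Params p m n r) (hr : r ≤ m - r) {u : (ZMod (p ^ m))ˣ} {a b : ℤ}
    (hab : (((u ^ ((p - 1) * p ^ (m - r - 1))) ^ a : (ZMod (p ^ m))ˣ) : ZMod (p ^ m)) *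
      (1 + (p : ZMod (p ^ m)) ^ (m - r) * b) = 1) :
    IsoCriterion h u a b ↔ IsCoprime (1 - 2 * b) (p : ℤ) := by
  rw [IsoCriterion, isoBase_eq hr hab, isCoprime_comm,
    (Nat.prime_iff_prime_int.1 h.prime).irreducible.coprime_iff_not_dvd, ne_eq, not_iff_not]
  have h1 : ZMod.castHom h.isoModulus_dvd (ZMod (p ^ (m - r + 1)))
      (1 + (1 - 2 * b) * (p : ZMod (p ^ m)) ^ (m - r)) =
      1 + (((1 - 2 * b) * (p : ℤ) ^ (m - r) : ℤ) : ZMod (p ^ (m - r + 1))) := by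
    simp only [map_add, map_one, map_mul, map_sub, map_pow, map_natCast, map_intCast, map_ofNat]
    push_cast
    rfl
  rw [h1, add_eq_left, ZMod.intCast_zmod_eq_zero_iff_dvd]
  push_cast
  rw [pow_succ', mul_dvd_mul_iff_right]
  exact pow_ne_zero _ (by exact_mod_cast h.prime.ne_zero)

theorem one_add_pow_eq {R : Type*} [CommRing R] {q : R} (hq : q ^ 2 = 0) (c : R) (j : ℕ) :
    (1 + c * q) ^ j = 1 + j * c * q := by
  induction j with
  | zero => simp
  | succ j ih =>
    rw [pow_succ, ih]
    push_cast
    linear_combination (j * c * c) * hq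

theorem isExponent_iff (h : Params p m n r) (hr : r ≤ m - r) {u : (ZMod (p ^ m))ˣ} {a b : ℤ}
    (hab : (((u ^ ((p - 1) * p ^ (m - r - 1))) ^ a : (ZMod (p ^ m))ˣ) : ZMod (p ^ m)) *
      (1 + (p : ZMod (p ^ m)) ^ (m - r) * b) = 1) {j : ℕ} :
    IsExponent p m r u a b j ↔ j.Coprime p ∧ (p : ℤ) ^ r ∣ j * (1 - 2 * b) - 1 := by
  rw [IsExponent, isoBase_eq hr hab, one_add_pow_eq (sq_eq_zero hr)]
  refine and_congr_right fun _ => ?_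
  rw [← Z_zpow_eq_iff h, Z_zpow, Z_zpow, X_zpow_eq_iff h]
  push_cast
  rw [mul_one, add_right_inj, mul_comm]

theorem exists_mul_sub_one_dvd {p : ℕ} {c : ℤ} (hc : IsCoprime c (p : ℤ)) (k : ℕ) :
    ∃ j : ℤ, (p : ℤ) ^ k ∣ j * c - 1 := by
  obtain ⟨x, y, hxy⟩ := hc.pow_right (n := k)
  exact ⟨x, -y, by linear_combination hxy⟩

theorem isCoprime_of_dvd_mul_sub_one {p r : ℕ} (hr : 1 ≤ r) {j c : ℤ}
    (hj : (p : ℤ) ^ r ∣ j * c - 1) : IsCoprime j (p : ℤ) := by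
  obtain ⟨t, ht⟩ := (dvd_pow_self (p : ℤ) (by omega : r ≠ 0)).trans hj
  exact ⟨c, -t, by linear_combination ht⟩

theorem exists_isExponent (h : Params p m n r) (hr : r ≤ m - r) {u : (ZMod (p ^ m))ˣ} {a b : ℤ}
    (hab : (((u ^ ((p - 1) * p ^ (m - r - 1))) ^ a : (ZMod (p ^ m))ˣ) : ZMod (p ^ m)) *
      (1 + (p : ZMod (p ^ m)) ^ (m - r) * b) = 1) (hiso : IsoCriterion h u a b) :
    ∃ j : ℕ, IsExponent p m r u a b j := by
  rw [isoCriterion_iff h hr hab] at hiso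
  obtain ⟨j, hj⟩ := exists_mul_sub_one_dvd hiso r
  have hp : (0 : ℤ) < (p : ℤ) ^ r := pow_pos (by exact_mod_cast h.prime.pos) _
  -- Reduction modulo p^r makes the exponent non-negative and preserves the congruence.
  lift j % (p : ℤ) ^ r to ℕ using Int.emod_nonneg _ hp.ne' with j' hj'
  have h1 : (p : ℤ) ^ r ∣ j' * (1 - 2 * b) - 1 := by
    rw [hj', Int.emod_def]
    obtain ⟨t, ht⟩ := hj
    exact ⟨t - j / (p : ℤ) ^ r * (1 - 2 * b), by linear_combination ht⟩
  refine ⟨j', (isExponent_iff h hr hab).2 ⟨?_, h1⟩⟩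
  exact Nat.isCoprime_iff_coprime.1 (isCoprime_of_dvd_mul_sub_one h.one_le_r h1)

theorem exists_coprime_mul_one_sub (h : Params p m n r) {l : ℤ} (hl : IsCoprime l (p : ℤ)) :
    ∃ b : ℤ, (p : ℤ) ^ r ∣ l * (1 - 2 * b) - 1 := by
  have h2 : IsCoprime (l * 2) (p : ℤ) := hl.mul_left (by
    have := Int.isCoprime_iff_gcd_eq_one.1 (Nat.isCoprime_iff_coprime.2
      ((Nat.coprime_two_left (n := p)).2 h.odd))
    exact_mod_cast Int.isCoprime_iff_gcd_eq_one.2 this)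
  obtain ⟨x, hx⟩ := exists_mul_sub_one_dvd h2 r
  -- With x inverse to 2l, this solves 2lb ≡ l - 1, a rearrangement of l(1 - 2b) ≡ 1.
  refine ⟨x * (l - 1), ?_⟩
  obtain ⟨t, ht⟩ := hx
  exact ⟨-(t * (l - 1)), by linear_combination -(l - 1) * ht⟩

end Equivariant

/-! ### Counting the admissible classes -/

section Count

variable {p m n r : ℕ}

theorem orderOf_generator (h : Params p m n r) {u : (ZMod (p ^ m))ˣ}
    (hu : ∀ z : (ZMod (p ^ m))ˣ, z ∈ Subgroup.zpowers u) :
    orderOf u = p ^ r * ((p - 1) * p ^ (m - r - 1)) := by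
  have : NeZero (p ^ m) := ⟨pow_ne_zero _ h.prime.ne_zero⟩
  rw [orderOf_eq_card_of_forall_mem_zpowers hu, Nat.card_eq_fintype_card]
  have h1 := h.two_le_m
  rw [ZMod.card_units_eq_totient, Nat.totient_prime_pow h.prime (by omega), mul_left_comm,
    mul_comm, ← pow_add]
  congr 2
  have := h.r_lt
  omega

theorem orderOf_uTilde (h : Params p m n r) {u : (ZMod (p ^ m))ˣ}
    (hu : ∀ z : (ZMod (p ^ m))ˣ, z ∈ Subgroup.zpowers u) :
    orderOf (u ^ ((p - 1) * p ^ (m - r - 1))) = p ^ r := by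
  have hp := h.prime.two_le
  have h0 : 0 < (p - 1) * p ^ (m - r - 1) := Nat.mul_pos (by omega) (pow_pos (by omega) _)
  rw [orderOf_pow_of_dvd h0.ne' (by rw [orderOf_generator h hu]; exact dvd_mul_left _ _),
    orderOf_generator h hu, Nat.mul_div_cancel _ h0]

/-- In the cyclic unit group, ũ generates the whole p^r-torsion. This supplies an exponent a for the
unit 1 - bq, whose p^r-th power is 1 - b p^m = 1. -/
theorem mem_zpowers_uTilde (h : Params p m n r) {u : (ZMod (p ^ m))ˣ}
    (hu : ∀ z : (ZMod (p ^ m))ˣ, z ∈ Subgroup.zpowers u) {v : (ZMod (p ^ m))ˣ}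
    (hv : v ^ p ^ r = 1) : ∃ a : ℤ, (u ^ ((p - 1) * p ^ (m - r - 1))) ^ a = v := by
  obtain ⟨e, rfl⟩ := hu v
  simp only at hv
  rw [← zpow_natCast, ← zpow_mul, ← orderOf_dvd_iff_zpow_eq_one, orderOf_generator h hu,
    mul_comm, Nat.cast_mul, mul_comm e] at hv
  have hp : ((p ^ r : ℕ) : ℤ) ≠ 0 := by exact_mod_cast pow_ne_zero _ h.prime.ne_zero
  rw [mul_comm, mul_dvd_mul_iff_left hp] at hv
  obtain ⟨a, rfl⟩ := hv
  exact ⟨a, by simp only [zpow_mul, zpow_natCast]⟩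

theorem exists_unit_exponent (h : Params p m n r) (hr : r ≤ m - r) {u : (ZMod (p ^ m))ˣ}
    (hu : ∀ z : (ZMod (p ^ m))ˣ, z ∈ Subgroup.zpowers u) (b : ℤ) :
    ∃ a : ℤ, (((u ^ ((p - 1) * p ^ (m - r - 1))) ^ a : (ZMod (p ^ m))ˣ) : ZMod (p ^ m)) *
      (1 + (p : ZMod (p ^ m)) ^ (m - r) * b) = 1 := by
  have hq := sq_eq_zero (p := p) hr
  let v : (ZMod (p ^ m))ˣ := ⟨1 + (-b) * (p : ZMod (p ^ m)) ^ (m - r),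
    1 + (p : ZMod (p ^ m)) ^ (m - r) * b, by linear_combination -(b : ZMod (p ^ m)) ^ 2 * hq,
    by linear_combination -(b : ZMod (p ^ m)) ^ 2 * hq⟩
  obtain ⟨a, ha⟩ := mem_zpowers_uTilde h hu (v := v) (by
    ext
    rw [Units.val_pow_eq_pow_val, one_add_pow_eq hq]
    have hm : p ^ m = p ^ (m - r) * p ^ r := by rw [← pow_add, Nat.sub_add_cancel h.r_lt.le]
    have this : ((p ^ (m - r) * p ^ r : ℕ) : ZMod (p ^ m)) = 0 := hm ▸ ZMod.natCast_self _
    push_cast at this ⊢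
    linear_combination -(b : ZMod (p ^ m)) * this)
  exact ⟨a, by rw [ha]; exact v.mul_inv⟩

theorem uTilde_zpow_eq_iff (h : Params p m n r) {u : (ZMod (p ^ m))ˣ}
    (hu : ∀ z : (ZMod (p ^ m))ˣ, z ∈ Subgroup.zpowers u) {a a' : ℤ} :
    (u ^ ((p - 1) * p ^ (m - r - 1))) ^ a = (u ^ ((p - 1) * p ^ (m - r - 1))) ^ a' ↔
      (a : ZMod (p ^ r)) = a' := by
  rw [zpow_eq_zpow_iff_modEq, orderOf_uTilde h hu, ZMod.intCast_eq_intCast_iff]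

theorem isUnit_one_sub_two_mul_iff (h : Params p m n r) (b : ℤ) :
    IsUnit (1 - 2 * (b : ZMod (p ^ r))) ↔ IsCoprime (1 - 2 * b) (p : ℤ) := by
  have := ZMod.coe_int_isUnit_iff_isCoprime (1 - 2 * b) (p ^ r)
  push_cast at this
  rw [this, isCoprime_comm, IsCoprime.pow_right_iff (by have := h.one_le_r; omega)]

theorem ncard_isUnit_one_sub_two_mul (h : Params p m n r) :
    {b : ZMod (p ^ r) | IsUnit (1 - 2 * b)}.ncard = (p - 1) * p ^ (r - 1) := by
  have : NeZero (p ^ r) := ⟨pow_ne_zero _ h.prime.ne_zero⟩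
  have h2 : IsUnit (2 : ZMod (p ^ r)) := by
    have := (ZMod.isUnit_iff_coprime 2 (p ^ r)).2
      (Nat.Coprime.pow_right _ ((Nat.coprime_two_left).2 h.odd))
    exact_mod_cast this
  obtain ⟨t, ht⟩ := h2
  -- Solve 1 - 2b = v for b; division by 2 is possible because p is odd.
  let f : (ZMod (p ^ r))ˣ → ZMod (p ^ r) := fun v => (1 - v) * (t⁻¹ : (ZMod (p ^ r))ˣ)
  have hf : Function.Injective f := by
    intro v w hvw
    have := (Units.mul_left_inj _).1 hvw
    ext
    linear_combination -this
  have h3 : {b : ZMod (p ^ r) | IsUnit (1 - 2 * b)} = Set.range f := by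
    ext b
    constructor
    · rintro ⟨v, hv⟩
      refine ⟨v, ?_⟩
      simp only [f, hv, ← ht]
      linear_combination b * t.mul_inv
    · rintro ⟨v, rfl⟩
      refine ⟨v, ?_⟩
      simp only [f, ← ht]
      linear_combination (1 - (v : ZMod (p ^ r))) * t.mul_inv
  rw [h3, ← Set.image_univ, Set.ncard_image_of_injective _ hf, Set.ncard_univ,
    Nat.card_eq_fintype_card, ZMod.card_units_eq_totient,
    Nat.totient_prime_pow h.prime (by have := h.one_le_r; omega), mul_comm]

/-- Projection to b is injective: qb depends only on b modulo p^r and determines ũ^a, hence a modulo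
p^r. -/
theorem ncard_admissibleClasses (h : Params p m n r) (hr : r ≤ m - r)
    (hcase : m ≤ n ∨ n ≤ m - r) {u : (ZMod (p ^ m))ˣ}
    (hu : ∀ z : (ZMod (p ^ m))ˣ, z ∈ Subgroup.zpowers u) :
    (admissibleClasses h u).ncard = (p - 1) * p ^ (r - 1) := by
  rw [← ncard_isUnit_one_sub_two_mul h]
  refine Set.ncard_congr (fun t _ => t.2.1) ?_ ?_ ?_
  · rintro _ ⟨a, b, hab, hiso, rfl⟩
    exact (isUnit_one_sub_two_mul_iff h b).2
      ((isoCriterion_iff h hr (unit_of_admissible h hr u hcase hab)).1 hiso)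
  · rintro _ _ ⟨a, b, hab, -, rfl⟩ ⟨a', b', hab', -, rfl⟩ hbb
    simp only at hbb
    have h1 := unit_of_admissible h hr u hcase hab
    have h2 := unit_of_admissible h hr u hcase hab'
    have h3 : (p : ZMod (p ^ m)) ^ (m - r) * b = (p : ZMod (p ^ m)) ^ (m - r) * b' := by
      have h4 : (p : ℤ) ^ r ∣ b - b' := by
        have := (ZMod.intCast_eq_intCast_iff_dvd_sub _ _ _).1 hbb.symm
        exact_mod_cast this
      rw [← Z_zpow_eq_iff h, Z_zpow, Z_zpow, X_zpow_eq_iff h] at h4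
      exact_mod_cast h4
    rw [h3] at h1
    have h5 := (uTilde_zpow_eq_iff h hu (a := a) (a' := a')).1 (by
      ext
      exact (IsUnit.of_mul_eq_one_right _ h2).mul_right_cancel (h1.trans h2.symm))
    rw [h5, hbb]
  · intro b hb
    obtain ⟨b, rfl⟩ := ZMod.intCast_surjective b
    obtain ⟨a, ha⟩ := exists_unit_exponent h hr hu b
    exact ⟨_, ⟨a, b, admissible_of_unit h hr u ha, (isoCriterion_iff h hr ha).2
      ((isUnit_one_sub_two_mul_iff h b).1 hb), rfl⟩, rfl⟩

end Count

/-! ### Power maps and the bijections attached to triplets -/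

section PowerMaps

variable {p m n r : ℕ}

/-- A single application is τ ↦ σ^c τ σ^(-(c+1)), and left and right multiplications commute. -/
theorem zpow_rho_mul_conj {H : Type*} [Group H] (σ : H) (c i : ℤ) (τ : H) :
    ((rho σ * autPerm (MulAut.conj (σ ^ c))) ^ i) τ = σ ^ (c * i) * τ * σ ^ (-((c + 1) * i)) := by
  have key : ∀ i : ℤ, (rho σ * autPerm (MulAut.conj (σ ^ c)))
      (σ ^ (c * i) * τ * σ ^ (-((c + 1) * i))) =
      σ ^ (c * (i + 1)) * τ * σ ^ (-((c + 1) * (i + 1))) := by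
    intro i
    rw [Equiv.Perm.mul_apply, autPerm_apply, rho_apply, MulAut.conj_apply,
      show c * (i + 1) = c + c * i by ring,
      show -((c + 1) * (i + 1)) = -((c + 1) * i) + (-c + -1) by ring, zpow_add, zpow_add, zpow_add,
      zpow_neg σ c, zpow_neg_one]
    simp only [mul_assoc]
  induction i with
  | zero => simp
  | succ i ih => rw [add_comm, zpow_one_add, Equiv.Perm.mul_apply, ih, key, add_comm]
  | pred i ih =>
    rw [sub_eq_neg_add, zpow_add, zpow_neg_one, Equiv.Perm.mul_apply, ih, Equiv.Perm.inv_eq_iff_eq,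
      key, neg_add_cancel_comm]

theorem isUnit_two (h : Params p m n r) (k : ℕ) : IsUnit (2 : ZMod (p ^ k)) := by
  have := (ZMod.isUnit_iff_coprime 2 (p ^ k)).2
    (Nat.Coprime.pow_right _ ((Nat.coprime_two_left).2 h.odd))
  exact_mod_cast this

theorem zpow_pow_eq_one (h : Params p m n r) (hr : r ≤ m - r) (σ : G p m n r) :
    σ ^ ((p : ℤ) ^ (m + n)) = 1 := by
  obtain ⟨i, k, rfl⟩ := exists_coord hr σ
  have := h.r_le_n
  rw [coord_zpow_of_dvd h hr (by omega)]
  have h1 := (coord_eq_iff h (i := i * p ^ (m + n)) (k := k * p ^ (m + n)) (i' := 0)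
    (k' := 0)).2 ⟨by
      rw [pow_add, ZMod.intCast_eq_intCast_iff_dvd_sub]
      exact ⟨-(i * p ^ n), by push_cast; ring⟩, by
      rw [pow_add, ZMod.intCast_eq_intCast_iff_dvd_sub]
      exact ⟨-(k * p ^ m), by push_cast; ring⟩⟩
  simpa using h1

/-- The power map with an exponent coprime to `p`, as a permutation of `G`. -/
theorem exists_powerPerm (h : Params p m n r) (hr : r ≤ m - r) {l : ℤ}
    (hl : IsCoprime l (p : ℤ)) : ∃ (f : Equiv.Perm (G p m n r)) (l' : ℤ),
      IsCoprime l' (p : ℤ) ∧ (∀ σ, f σ = σ ^ l) ∧ ∀ σ, f⁻¹ σ = σ ^ l' := by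
  obtain ⟨l', hl'⟩ := exists_mul_sub_one_dvd hl (m + n)
  have key : ∀ σ : G p m n r, σ ^ (l' * l) = σ := by
    intro σ
    obtain ⟨t, ht⟩ := hl'
    rw [← sub_add_cancel (l' * l) 1, ht, zpow_add, zpow_mul, zpow_pow_eq_one h hr, one_zpow,
      one_mul, zpow_one]
  refine ⟨⟨fun σ => σ ^ l, fun σ => σ ^ l', fun σ => ?_, fun σ => ?_⟩, l', ?_, fun _ => rfl,
    fun _ => rfl⟩
  · simp only [← zpow_mul, mul_comm l, key]
  · simp only [← zpow_mul, key]
  · exact isCoprime_of_dvd_mul_sub_one (by have := h.two_le_m; omega) hl'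

/-- Both sides are x^(-i) y^(-jk) up to a power of z. The unit v = 1/j corrects the exponent of x,
which α_v scales and the power -j scales back. -/
theorem isPi_iff (h : Params p m n r) (hr : r ≤ m - r) {u : (ZMod (p ^ m))ˣ} {a b : ℤ}
    (hab : (((u ^ ((p - 1) * p ^ (m - r - 1))) ^ a : (ZMod (p ^ m))ˣ) : ZMod (p ^ m)) *
      (1 + (p : ZMod (p ^ m)) ^ (m - r) * b) = 1) {j : ℕ} (hj : IsExponent p m r u a b j)
    {v : (ZMod (p ^ m))ˣ} (hv : (v : ZMod (p ^ m)) * j = 1) (π : Equiv.Perm (G p m n r)) :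
    IsPi h u a b 0 j π ↔ ∀ σ, π σ = alpha h v σ ^ (-(j : ℤ)) := by
  have key : ∀ i k : ℤ, (PhiX h b ^ i * PhiY h u a 0 ^ ((j : ℤ) * k)) 1 =
      alpha h v (X p m n r ^ i * Y p m n r ^ k) ^ (-(j : ℤ)) := by
    intro i k
    obtain ⟨w, hw⟩ := ZMod.intCast_surjective (v : ZMod (p ^ m))
    rw [PhiX, PhiY, zpow_zero, mul_one, alphaTilde_zpow, alpha_eq_conj h hr _ hab,
      betaTilde_zpow_eq_conj h hr, Equiv.Perm.mul_apply, zpow_rho_mul_conj, zpow_rho_mul_conj,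
      mul_one, ← zpow_add, mul_assoc, Y_zpow_mul_X_zpow hr, Z_zpow, ← mul_assoc, ← mul_assoc,
      ← zpow_add, ← zpow_add, map_mul, map_zpow, map_zpow, alpha_Y, alpha_X_eq h v hw, ← zpow_mul,
      coord_zpow hr, coord_eq_iff h]
    rw [← hw] at hv
    have h1 := ((isExponent_iff h hr hab).1 hj).2
    rw [← Z_zpow_eq_iff h, Z_zpow, Z_zpow, X_zpow_eq_iff h] at h1
    have h2 := congrArg (Int.cast : ℤ → ZMod (p ^ m)) (two_mul_triangle (-(j : ℤ)))
    generalize -(j : ℤ) * (-(j : ℤ) - 1) / 2 = T at h2 ⊢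
    push_cast at h1 h2 ⊢
    -- Doubling clears the triangular number; the powers of z agree since 2j(1 - b) ≡ j + 1 modulo
    -- p^r, equivalent to j(1 - 2b) ≡ 1.
    refine ⟨(isUnit_two h m).mul_left_cancel ?_, by ring⟩
    linear_combination (2 * i - (p : ZMod (p ^ m)) ^ (m - r) * i * k * (j + 1)) * hv + i * k * h1 -
      ((p : ZMod (p ^ m)) ^ (m - r) * w * i * k) * h2
  constructor
  · intro H σ
    obtain ⟨i, k, rfl⟩ := exists_coord hr σ
    rw [H, key]
  · intro H i k
    rw [H, key]

theorem pi_eqModAut (h : Params p m n r) (hr : r ≤ m - r) {u : (ZMod (p ^ m))ˣ} {a b : ℤ}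
    (hab : (((u ^ ((p - 1) * p ^ (m - r - 1))) ^ a : (ZMod (p ^ m))ˣ) : ZMod (p ^ m)) *
      (1 + (p : ZMod (p ^ m)) ^ (m - r) * b) = 1) {j : ℕ} (hj : IsExponent p m r u a b j) :
    (∃! π : Equiv.Perm (G p m n r), IsPi h u a b 0 j π) ∧
      ∀ π : Equiv.Perm (G p m n r), IsPi h u a b 0 j π →
        EqModAut π (powerMap (G p m n r) (-(j : ℤ))) := by
  have hu : IsUnit (j : ZMod (p ^ m)) :=
    (ZMod.isUnit_iff_coprime j (p ^ m)).2 (hj.1.pow_right m)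
  have hv : ((hu.unit⁻¹ : (ZMod (p ^ m))ˣ) : ZMod (p ^ m)) * j = 1 := hu.val_inv_mul
  have key := isPi_iff h hr hab hj hv
  constructor
  · obtain ⟨f, -, -, hf, -⟩ := exists_powerPerm h hr (l := -(j : ℤ))
      (Nat.isCoprime_iff_coprime.2 hj.1).neg_left
    refine ⟨f * autPerm (alpha h hu.unit⁻¹), (key _).2 fun σ => ?_, fun π hπ => ?_⟩
    · rw [Equiv.Perm.mul_apply, hf, autPerm_apply]
    · ext σ
      rw [(key π).1 hπ, Equiv.Perm.mul_apply, hf, autPerm_apply]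
  · intro π hπ
    exact ⟨⟨_, funext ((key π).1 hπ)⟩, ⟨alpha h hu.unit⁻¹, funext fun σ => by
      rw [(key π).1 hπ, Function.comp_apply, powerMap, map_zpow]⟩⟩

/-- The two sides differ by a power of z. Twice its exponent is a multiple of l(1 - 2b) - 1, and 2
is invertible modulo p^r. -/
theorem mul_zpow_twisted (h : Params p m n r) (hr : r ≤ m - r) {l b : ℤ}
    (hl : (p : ℤ) ^ r ∣ l * (1 - 2 * b) - 1) (σ τ : G p m n r) :
    (σ * τ) ^ l = (τ ^ l) ^ b * σ ^ l * (τ ^ l) ^ (1 - b) := by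
  obtain ⟨w, hw⟩ := exists_zpow_commutator hr σ τ
  have h1 := hw 1 1
  rw [zpow_one, zpow_one, mul_one, mul_one] at h1
  have h2 : (τ ^ l) ^ b * σ ^ l =
      Z p m n r ^ (-(w * (l * (l * b)))) * (σ ^ l * τ ^ (l * b)) := by
    rw [hw, ← mul_assoc, ← zpow_add, neg_add_cancel, zpow_zero, one_mul, zpow_mul]
  rw [h2, mul_zpow_eq hr h1, mul_assoc, mul_assoc (σ ^ l), ← zpow_mul τ, ← zpow_add,
    show l * b + l * (1 - b) = l by ring, mul_left_inj, Z_zpow_eq_iff h]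
  have h3 := two_mul_triangle l
  have h4 : IsCoprime ((p : ℤ) ^ r) 2 := by
    have := Nat.isCoprime_iff_coprime.2 (((Nat.coprime_two_left (n := p)).2 h.odd).pow_right r)
    exact_mod_cast this.symm
  refine h4.dvd_of_dvd_mul_left ?_
  obtain ⟨t, ht⟩ := hl
  exact ⟨-(w * l * t), by linear_combination -w * h3 - w * l * ht⟩

end PowerMaps

/-! ### Elements of NHol of an arbitrary group -/

section MultipleHolomorph

variable {H : Type*} [Group H]

theorem perm_apply_inv_self {α : Type*} (f : Equiv.Perm α) (x : α) : f (f⁻¹ x) = x :=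
  f.apply_symm_apply x

theorem rho_mem_holomorph (σ : H) : rho σ ∈ holomorph H := ⟨σ, 1, by ext; rfl⟩

theorem autPerm_mem_holomorph (φ : MulAut H) : autPerm φ ∈ holomorph H :=
  ⟨φ⁻¹ 1, φ, by ext; simp [rho_apply]⟩

/-- The twisted law rewrites f(σs⁻¹) as conjugation of f(σ) by f(s⁻¹)^b followed by right
multiplication by f(s⁻¹). -/
theorem conj_mem_holomorph {f : Equiv.Perm H} {b : ℤ}
    (hf : ∀ σ τ, f (σ * τ) = f τ ^ b * f σ * f τ ^ (1 - b))
    (hφ : ∀ (φ : MulAut H) (σ), f (φ σ) = φ (f σ)) {g : Equiv.Perm H} (hg : g ∈ holomorph H) :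
    f * g * f⁻¹ ∈ holomorph H := by
  obtain ⟨s, φ, rfl⟩ := hg
  refine ⟨(f s⁻¹)⁻¹, MulAut.conj (f s⁻¹ ^ b) * φ, ?_⟩
  ext σ
  simp only [Equiv.Perm.mul_apply, rho_apply, autPerm_apply, hf, hφ, perm_apply_inv_self,
    MulAut.mul_apply, MulAut.conj_apply, inv_inv]
  rw [mul_assoc _ (f s⁻¹ ^ b)⁻¹, ← zpow_neg, ← zpow_add_one, neg_add_eq_sub]

/-- Conjugating right translations by π gives automorphisms Φ(τ) with π(στ) = Φ(τ)(π(σ)) π(τ); then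
Γ(s) = Φ(π⁻¹(s⁻¹)). Conjugating automorphisms by π⁻¹ gives equivariance. -/
theorem exists_antihom_of_mem_multipleHolomorph {π : Equiv.Perm H}
    (hπ : π ∈ multipleHolomorph H) (h1 : π 1 = 1) :
    ∃ Γ : H → MulAut H, IsAntihom Γ ∧ IsAutEquivariant Γ ∧
      ∀ σ τ, π (σ * τ) = Γ (π τ)⁻¹ (π σ) * π τ := by
  have hΦ : ∀ τ, ∃ φ : MulAut H, ∀ σ, π (σ * τ) = φ (π σ) * π τ := by
    intro τ
    obtain ⟨s, φ, hs⟩ := (Subgroup.mem_normalizer_iff.1 hπ (rho τ⁻¹)).1 (rho_mem_holomorph _)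
    have h2 : ∀ σ, π (σ * τ) = φ (π σ) * s⁻¹ := by
      intro σ
      have := DFunLike.congr_fun hs (π σ)
      simpa [rho_apply, autPerm_apply] using this
    have h3 := h2 1
    rw [one_mul, h1, map_one, one_mul] at h3
    exact ⟨φ, fun σ => by rw [h2, h3]⟩
  choose Φ hΦ using hΦ
  have hΦ_ext : ∀ φ ψ : MulAut H, (∀ σ, φ (π σ) = ψ (π σ)) → φ = ψ := by
    intro φ ψ hφψ
    ext σ
    simpa using hφψ (π⁻¹ σ)
  have hmul : ∀ σ τ, Φ (σ * τ) = Φ τ * Φ σ := by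
    intro σ τ
    apply hΦ_ext
    intro υ
    have h2 := hΦ τ (υ * σ)
    rw [mul_assoc, hΦ, hΦ, hΦ σ υ, map_mul, mul_assoc, mul_left_inj] at h2
    exact h2
  have hequiv : ∀ φ : MulAut H, ∃ ψ : MulAut H, ∀ σ, φ (π σ) = π (ψ σ) := by
    intro φ
    obtain ⟨s, ψ, hs⟩ := (Subgroup.mem_normalizer_iff.1 (inv_mem hπ) (autPerm φ)).1
      (autPerm_mem_holomorph _)
    have h2 : ∀ σ, φ (π σ) = π (ψ σ * s⁻¹) := by
      intro σ
      have := DFunLike.congr_fun hs σ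
      simp only [Equiv.Perm.mul_apply, inv_inv, Equiv.Perm.inv_eq_iff_eq] at this
      exact this
    have h3 := h2 1
    rw [h1, map_one, map_one, one_mul] at h3
    have h4 := π.injective (h3.symm.trans h1.symm)
    exact ⟨ψ, fun σ => by rw [h2, h4, mul_one]⟩
  have hE : IsAutEquivariant fun s => Φ (π⁻¹ s⁻¹) := by
    intro φ s
    obtain ⟨ψ, hψ⟩ := hequiv φ
    have h2 : π⁻¹ (φ s)⁻¹ = ψ (π⁻¹ s⁻¹) := by
      rw [Equiv.Perm.inv_eq_iff_eq, ← hψ, perm_apply_inv_self, map_inv]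
    simp only [h2]
    rw [eq_mul_inv_iff_mul_eq]
    apply hΦ_ext
    intro σ
    have h3 := congrArg φ (hΦ (π⁻¹ s⁻¹) σ)
    rw [hψ, map_mul ψ, map_mul φ, hΦ, hψ (π⁻¹ s⁻¹), mul_left_inj, ← hψ] at h3
    exact h3
  refine ⟨fun s => Φ (π⁻¹ s⁻¹), ?_, hE, fun σ τ => by simp [hΦ]⟩
  -- A priori Γ is multiplicative only for s ∘ t = s·Γ(s)(t). Replacing t by Γ(s)⁻¹(t) and using
  -- equivariance turns this into Γ(st) = Γ(t)Γ(s).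
  have hcirc : ∀ s t, Φ (π⁻¹ (s * Φ (π⁻¹ s⁻¹) t)⁻¹) = Φ (π⁻¹ s⁻¹) * Φ (π⁻¹ t⁻¹) := by
    intro s t
    rw [← hmul]
    congr 1
    rw [Equiv.Perm.inv_eq_iff_eq, hΦ]
    simp
  intro s t
  have h2 := hcirc s ((Φ (π⁻¹ s⁻¹))⁻¹ t)
  have h3 := hE (Φ (π⁻¹ s⁻¹))⁻¹ t
  simp only at h3 ⊢
  rw [h3, ← MulAut.mul_apply, mul_inv_cancel, MulAut.one_apply] at h2
  rw [h2]
  group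

end MultipleHolomorph

/-! ### Determination of T(G) for n ≤ m - r -/

section Classification

variable {p m n r : ℕ}

theorem powerPerm_mem_multipleHolomorph (h : Params p m n r) (hr : r ≤ m - r) {l : ℤ}
    (hl : IsCoprime l (p : ℤ)) {f : Equiv.Perm (G p m n r)} (hf : ∀ σ, f σ = σ ^ l) :
    f ∈ multipleHolomorph (G p m n r) := by
  obtain ⟨g, l', hl', hg, hg'⟩ := exists_powerPerm h hr hl
  obtain rfl : f = g := by ext σ; rw [hf, hg]
  have key : ∀ (e : Equiv.Perm (G p m n r)) (i : ℤ), IsCoprime i (p : ℤ) → (∀ σ, e σ = σ ^ i) →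
      ∀ k ∈ holomorph (G p m n r), e * k * e⁻¹ ∈ holomorph (G p m n r) := by
    intro e i hi he k hk
    obtain ⟨b, hb⟩ := exists_coprime_mul_one_sub h hi
    refine conj_mem_holomorph (b := b) (fun σ τ => ?_) (fun φ σ => ?_) hk
    · rw [he, he, he, mul_zpow_twisted h hr hb]
    · rw [he, he, map_zpow]
  refine Subgroup.mem_normalizer_iff.2 fun k => ⟨key f l hl hf k, fun hk => ?_⟩
  have := key f⁻¹ l' hl' hg' _ hk
  simpa [mul_assoc] using this

/-- Meant for ψ = Γ(y), as α fixes y. The unit 2 suffices: the unwanted coordinates satisfy k = 2k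
and i' = 2i'. -/
theorem coord_image_Y (h : Params p m n r) (hr : r ≤ m - r) {ψ : MulAut (G p m n r)}
    (hψ : ∀ v : (ZMod (p ^ m))ˣ, ψ * alpha h v = alpha h v * ψ) :
    ∃ a d : ℤ, ψ (X p m n r) = X p m n r ^ a ∧ ψ (Y p m n r) = Y p m n r ^ d := by
  obtain ⟨t, ht⟩ := isUnit_two h m
  have hX := alpha_X_eq (v := 2) h t (by rw [ht]; norm_cast)
  obtain ⟨i, k, h1⟩ := exists_coord hr (ψ (X p m n r))
  obtain ⟨i', k', h2⟩ := exists_coord hr (ψ (Y p m n r))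
  have h3 := DFunLike.congr_fun (hψ t) (X p m n r)
  have h4 := DFunLike.congr_fun (hψ t) (Y p m n r)
  simp only [MulAut.mul_apply, hX, alpha_Y, map_zpow, map_mul, h1, h2] at h3 h4
  rw [coord_zpow hr, ← zpow_mul, coord_eq_iff h] at h3
  rw [← zpow_mul, coord_eq_iff h] at h4
  have h5 := h3.2
  have h6 := h4.1
  push_cast at h5 h6
  have hk : (k : ZMod (p ^ n)) = (0 : ℤ) := by push_cast; linear_combination h5
  have hi : (i' : ZMod (p ^ m)) = (0 : ℤ) := by push_cast; linear_combination -h6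
  refine ⟨i, k', ?_, ?_⟩
  · rw [h1, Y_zpow_congr hk, zpow_zero, mul_one]
  · rw [h2, X_zpow_congr hi, zpow_zero, one_mul]

theorem X_zpow_pow_commute_Y (h : Params p m n r) (hr : r ≤ m - r) (hn : n ≤ m - r) :
    Commute (X p m n r ^ ((p : ℤ) ^ (m - n))) (Y p m n r) := by
  have h1 := Y_zpow_mul_X_zpow (n := n) (p := p) hr 1 ((p : ℤ) ^ (m - n))
  rw [(Z_zpow_eq_one_iff h).2, one_mul, zpow_one] at h1
  · exact h1.symm
  · rw [one_mul]
    exact pow_dvd_pow _ (by have := h.r_lt; omega)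

theorem apply_X_of_commute_beta (h : Params p m n r) (hr : r ≤ m - r) (hn : n ≤ m - r)
    {ψ : MulAut (G p m n r)} (hψ : ψ * beta h = beta h * ψ) :
    ∃ i : ℤ, ψ (X p m n r) = X p m n r ^ i := by
  have hβ : beta h (Y p m n r) = X p m n r ^ ((p : ℤ) ^ (m - n)) * Y p m n r := by
    rw [beta_Y, ← zpow_natCast]
    push_cast
    rfl
  obtain ⟨i, k, h1⟩ := exists_coord hr (ψ (X p m n r))
  have h2 := DFunLike.congr_fun hψ (X p m n r)
  simp only [MulAut.mul_apply, beta_X, hβ, map_zpow, map_mul, h1] at h2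
  rw [(X_zpow_pow_commute_Y h hr hn).mul_zpow, ← mul_assoc, ← zpow_mul, ← zpow_add,
    coord_eq_iff h, ZMod.intCast_eq_intCast_iff_dvd_sub, add_sub_cancel_left] at h2
  have h3 := h2.1
  have h4 : ((p ^ m : ℕ) : ℤ) = (p : ℤ) ^ (m - n) * p ^ n := by
    push_cast
    rw [← pow_add]
    congr 1
    omega
  rw [h4, mul_dvd_mul_iff_left (pow_ne_zero _ (by exact_mod_cast h.prime.ne_zero))] at h3
  have hk : (k : ZMod (p ^ n)) = (0 : ℤ) := by
    rw [eq_comm, ZMod.intCast_eq_intCast_iff_dvd_sub]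
    push_cast
    rwa [sub_zero]
  exact ⟨i, by rw [h1, Y_zpow_congr hk, zpow_zero, mul_one]⟩

/-- Meant for ψ = Γ(x): since α_2(x) = x², conjugation by α_2 squares ψ. Comparing coordinates gives
i = i² and k = k², and both are units. -/
theorem apply_of_conj_alpha_eq_sq (h : Params p m n r) (hr : r ≤ m - r)
    {ψ : MulAut (G p m n r)} {t : (ZMod (p ^ m))ˣ} (ht : (t : ZMod (p ^ m)) = 2)
    (hψ : alpha h t * ψ = ψ * ψ * alpha h t) {i : ℤ} (hi : ψ (X p m n r) = X p m n r ^ i) :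
    ψ (X p m n r) = X p m n r ∧ ∃ j : ℤ, ψ (Y p m n r) = X p m n r ^ j * Y p m n r := by
  have hX := alpha_X_eq (v := 2) h t (by rw [ht]; norm_cast)
  obtain ⟨j, k, hj⟩ := exists_coord hr (ψ (Y p m n r))
  have preimage : ∀ σ : G p m n r, ∃ a b c : ℤ,
      σ = X p m n r ^ (i * a + j * b + (p : ℤ) ^ (m - r) * c) * Y p m n r ^ (k * b) := by
    intro σ
    obtain ⟨a, b, hab⟩ := exists_coord hr (ψ⁻¹ σ)
    refine ⟨a, b, j * k * (b * (b - 1) / 2), ?_⟩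
    have h1 := congrArg ψ hab
    rw [map_mul, map_zpow, map_zpow, hi, hj, coord_zpow hr, ← zpow_mul, ← mul_assoc,
      ← zpow_add, MulAut.apply_inv_self] at h1
    rw [h1]
    ring_nf
  have hk : IsUnit (k : ZMod (p ^ n)) := by
    obtain ⟨a, b, c, h1⟩ := preimage (Y p m n r)
    have h2 := (coord_eq_iff h (i := 0) (k := 1)).1
      (Eq.trans (by rw [zpow_zero, one_mul, zpow_one]) h1)
    have h3 := h2.2
    push_cast at h3
    exact IsUnit.of_mul_eq_one _ h3.symm
  -- If p divided i, then ψ would kill the nontrivial element x^(p^(m-1)).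
  have hiu : IsUnit (i : ZMod (p ^ m)) := by
    have h5 := ψ.injective.eq_iff (a := X p m n r ^ ((p : ℤ) ^ (m - 1))) (b := 1)
    rw [ZMod.coe_int_isUnit_iff_isCoprime]
    push_cast
    apply IsCoprime.pow_left
    rw [(Nat.prime_iff_prime_int.1 h.prime).irreducible.coprime_iff_not_dvd]
    rintro ⟨e, rfl⟩
    have hm := h.two_le_m
    have hpm : (p : ℤ) ^ m = p * p ^ (m - 1) := by rw [← pow_succ']; congr 1; omega
    rw [map_zpow, map_one, hi, ← zpow_mul, ← zpow_zero (X p m n r), X_zpow_eq_iff h,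
      X_zpow_eq_iff h, eq_comm, ZMod.intCast_eq_intCast_iff_dvd_sub, eq_comm,
      ZMod.intCast_eq_intCast_iff_dvd_sub] at h5
    push_cast at h5
    have h6 := h5.1 ⟨e, by rw [hpm]; ring⟩
    rw [sub_zero] at h6
    have h7 := (pow_dvd_pow_iff (by exact_mod_cast h.prime.ne_zero)
      (by rw [Int.isUnit_iff]; have := h.prime.two_le; omega)).1 h6
    omega
  have h1 := DFunLike.congr_fun hψ (X p m n r)
  have h2 := DFunLike.congr_fun hψ (Y p m n r)
  simp only [MulAut.mul_apply, hX, alpha_Y, map_zpow, map_mul, hi, hj] at h1 h2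
  have hk1 : (k : ZMod (p ^ n)) = (1 : ℤ) := by
    rw [coord_zpow hr, ← mul_assoc, ← zpow_mul, ← zpow_mul, ← zpow_add, coord_eq_iff h] at h2
    have h3 := h2.2
    push_cast at h3 ⊢
    exact hk.mul_left_cancel (by rw [mul_one, ← h3])
  have hi1 : (i : ZMod (p ^ m)) = (1 : ℤ) := by
    rw [← zpow_mul, ← zpow_mul, ← zpow_mul, X_zpow_eq_iff h] at h1
    push_cast at h1 ⊢
    exact (isUnit_two h m).mul_left_cancel (hiu.mul_left_cancel (by linear_combination -h1))
  rw [hi, hj, X_zpow_congr hi1, Y_zpow_congr hk1, zpow_one, zpow_one]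
  exact ⟨rfl, j, rfl⟩

/-- Commuting with δ forces x^(j p^r) = 1, so p^(m-r) divides j. -/
theorem apply_Y_of_commute_delta (h : Params p m n r) (hr : r ≤ m - r)
    {ψ : MulAut (G p m n r)} (hψ : ψ * delta h = delta h * ψ) {j : ℤ}
    (hj : ψ (Y p m n r) = X p m n r ^ j * Y p m n r) :
    ∃ b : ℤ, ψ (Y p m n r) = Z p m n r ^ b * Y p m n r := by
  have h1 := DFunLike.congr_fun hψ (Y p m n r)
  have hY : delta h (Y p m n r) = Y p m n r * Y p m n r ^ ((p : ℤ) ^ r) := by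
    rw [delta_Y, pow_add, pow_one, ← zpow_natCast _ (p ^ r)]
    push_cast
    rfl
  have h2 := coord_zpow_of_dvd (n := n) h hr le_rfl j 1
  rw [one_mul, zpow_one] at h2
  simp only [MulAut.mul_apply, hY, delta_X, map_zpow, map_mul, hj, h2] at h1
  simp only [mul_assoc, mul_right_inj, mul_eq_right] at h1
  rw [← zpow_zero (X p m n r), X_zpow_eq_iff h, eq_comm, ZMod.intCast_eq_intCast_iff_dvd_sub,
    sub_zero] at h1
  have h3 : ((p ^ m : ℕ) : ℤ) = (p : ℤ) ^ (m - r) * p ^ r := by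
    rw [← pow_add, Nat.sub_add_cancel h.r_lt.le]
    push_cast
    rfl
  rw [h3, mul_dvd_mul_iff_right (pow_ne_zero _ (by exact_mod_cast h.prime.ne_zero))] at h1
  obtain ⟨b, rfl⟩ := h1
  exact ⟨b, by rw [hj, Z_zpow]⟩

theorem exists_eq_conj (h : Params p m n r) (hr : r ≤ m - r) (hn : n ≤ m - r)
    {Γ : G p m n r → MulAut (G p m n r)} (hΓ : IsAntihom Γ) (hΓ' : IsAutEquivariant Γ) :
    ∃ b : ℤ, Γ = fun σ => MulAut.conj (σ ^ (-b)) := by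
  have hcomm : ∀ φ σ, φ σ = σ → Γ σ * φ = φ * Γ σ := by
    intro φ σ hφ
    have := hΓ' φ σ
    rw [hφ, eq_mul_inv_iff_mul_eq] at this
    exact this
  obtain ⟨a, d, hyx, hyy⟩ := coord_image_Y h hr fun v => hcomm _ (Y p m n r) (alpha_Y h v)
  obtain ⟨i, hi⟩ := apply_X_of_commute_beta h hr hn (hcomm _ _ (beta_X h))
  obtain ⟨t, ht⟩ := isUnit_two h m
  obtain ⟨hxx, j, hj⟩ := apply_of_conj_alpha_eq_sq h hr ht (by
    have h1 := hΓ' (alpha h t) (X p m n r)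
    rw [alpha_X_eq (v := 2) h t (by rw [ht]; norm_cast), zpow_two, hΓ,
      eq_mul_inv_iff_mul_eq] at h1
    exact h1.symm) hi
  obtain ⟨b, hxy⟩ := apply_Y_of_commute_delta h hr (hcomm _ _ (delta_X h)) hj
  obtain ⟨ha, hd⟩ := unit_of_gamma_equivariant h hr hΓ hΓ' hn hxx hxy hyx hyy
  have hau : IsUnit (a : ZMod (p ^ m)) := IsUnit.of_mul_eq_one _ ha
  refine ⟨b, IsAntihom.ext hΓ (isAntihom_conj_zpow hr (-b)) ?_ ?_⟩
  · apply mulAut_ext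
    · rw [hxx, conj_X_zpow_X]
    · rw [hxy, conj_X_zpow_Y hr, neg_neg]
  · rw [← alpha_eq_conj h hr hau.unit ha]
    apply mulAut_ext
    · rw [hyx, alpha_X_eq h _ (v := a) rfl]
    · rw [hyy, alpha_Y, Y_zpow_congr (j := 1) (by push_cast; exact hd), zpow_one]

theorem map_pow_of_twisted {H : Type*} [Group H] {f : H → H} {b : ℤ} (h1 : f 1 = 1)
    (hf : ∀ σ τ, f (σ * τ) = f τ ^ b * f σ * f τ ^ (1 - b)) (σ : H) (k : ℕ) :
    f (σ ^ k) = f σ ^ k := by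
  induction k with
  | zero => simpa using h1
  | succ k ih =>
    rw [pow_succ, hf, ih, ← zpow_natCast, ← zpow_natCast, ← zpow_add, ← zpow_add]
    congr 1
    push_cast
    ring

/-- With e = p^(r-1), the images of y^e x and x y^e differ by a power of z with exponent divisible
by e(1 - 2b). If p divided 1 - 2b they would coincide, so y^e and x would commute, contradicting
that z has order p^r. -/
theorem isCoprime_of_twisted (h : Params p m n r) (hr : r ≤ m - r) {π : Equiv.Perm (G p m n r)}
    {b : ℤ} (h1 : π 1 = 1) (hπ : ∀ σ τ, π (σ * τ) = π τ ^ b * π σ * π τ ^ (1 - b)) :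
    IsCoprime (1 - 2 * b) (p : ℤ) := by
  rw [isCoprime_comm, (Nat.prime_iff_prime_int.1 h.prime).irreducible.coprime_iff_not_dvd]
  rintro ⟨c, hc⟩
  set x := X p m n r
  set y := Y p m n r
  obtain ⟨w, hw⟩ := exists_zpow_commutator hr (π y) (π x)
  have hr1 := h.one_le_r
  have key : y ^ (p ^ (r - 1)) * x = x * y ^ (p ^ (r - 1)) := by
    apply π.injective
    rw [hπ, hπ, map_pow_of_twisted h1 hπ]
    set e := p ^ (r - 1) with he
    have h2 : π x ^ b * π y ^ e * π x ^ (1 - b) =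
        Z p m n r ^ (-(w * (e * b))) * (π y ^ (e : ℤ) * π x) := by
      rw [← zpow_natCast, eq_comm, ← mul_inv_eq_iff_eq_mul, ← zpow_neg, neg_sub, mul_assoc,
        mul_assoc, ← zpow_one_add, add_sub_cancel, hw, ← mul_assoc, ← zpow_add, neg_add_cancel,
        zpow_zero, one_mul]
    have h3 : (π y ^ e) ^ b * π x * (π y ^ e) ^ (1 - b) =
        Z p m n r ^ (-(w * (e * (1 - b)))) * (π y ^ (e : ℤ) * π x) := by
      have h4 := hw (e * (1 - b)) 1
      rw [zpow_one, mul_one] at h4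
      have h5 : π x * π y ^ ((e : ℤ) * (1 - b)) =
          Z p m n r ^ (-(w * (e * (1 - b)))) * (π y ^ ((e : ℤ) * (1 - b)) * π x) := by
        rw [h4, ← mul_assoc, ← zpow_add, neg_add_cancel, zpow_zero, one_mul]
      rw [← zpow_natCast, ← zpow_mul, ← zpow_mul, mul_assoc, h5, ← mul_assoc,
        ← ((commute_Z hr _).zpow_left _).eq, mul_assoc, ← mul_assoc (π y ^ _), ← zpow_add]
      congr 3
      ring
    rw [h2, h3, mul_left_inj, Z_zpow_eq_iff h]
    have h5 : (p : ℤ) ^ r = p * e := by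
      rw [he]
      push_cast
      rw [← pow_succ']
      congr 1
      omega
    rw [h5]
    exact ⟨w * c, by linear_combination w * e * hc⟩
  have h2 := Y_zpow_mul_X_zpow (n := n) (p := p) hr (p ^ (r - 1) : ℕ) 1
  rw [zpow_one, zpow_natCast, key, right_eq_mul, Z_zpow_eq_one_iff h, mul_one] at h2
  push_cast at h2
  have h7 := (pow_dvd_pow_iff (by exact_mod_cast h.prime.ne_zero)
      (by rw [Int.isUnit_iff]; have := h.prime.two_le; omega)).1 h2
  omega

theorem exists_powerMap_comp_aut (h : Params p m n r) (hr : r ≤ m - r) (hn : n ≤ m - r)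
    {π : Equiv.Perm (G p m n r)} (hπ : π ∈ multipleHolomorph (G p m n r)) (h1 : π 1 = 1) :
    ∃ l : ℤ, IsCoprime l (p : ℤ) ∧ ∃ φ : MulAut (G p m n r), ∀ σ, π σ = φ σ ^ l := by
  obtain ⟨Γ, hΓ, hΓ', hπΓ⟩ := exists_antihom_of_mem_multipleHolomorph hπ h1
  obtain ⟨b, rfl⟩ := exists_eq_conj h hr hn hΓ hΓ'
  have hπb : ∀ σ τ, π (σ * τ) = π τ ^ b * π σ * π τ ^ (1 - b) := by
    intro σ τ
    rw [hπΓ]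
    simp only [MulAut.conj_apply, inv_zpow, zpow_neg, inv_inv, mul_assoc]
    rw [zpow_sub, zpow_one, ((Commute.refl (π τ)).zpow_right b).inv_right.eq]
  obtain ⟨l, hl⟩ := exists_mul_sub_one_dvd (isCoprime_of_twisted h hr h1 hπb) r
  have hlp := isCoprime_of_dvd_mul_sub_one h.one_le_r hl
  obtain ⟨f, -, -, hf, -⟩ := exists_powerPerm (n := n) h hr hlp
  -- π and the power map f obey the same twisted law, so f⁻¹π is multiplicative.
  refine ⟨l, hlp, MulEquiv.mk' (f⁻¹ * π) fun σ τ => ?_, fun σ => ?_⟩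
  · apply f.injective
    have h2 : ∀ σ, f ((f⁻¹ * π) σ) = π σ := fun σ => by simp
    rw [h2, hf, mul_zpow_twisted h hr hl, ← hf, ← hf, h2, h2, hπb]
  · rw [← hf]
    exact (perm_apply_inv_self f (π σ)).symm

theorem exists_powerMap_representative (h : Params p m n r) (hr : r ≤ m - r) (hn : n ≤ m - r)
    (t : T (G p m n r)) : ∃ l : ℤ, IsCoprime l (p : ℤ) ∧
      ∃ τ : multipleHolomorph (G p m n r),
        ⇑(τ : Equiv.Perm (G p m n r)) = powerMap (G p m n r) l ∧ t = QuotientGroup.mk τ := by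
  obtain ⟨π, rfl⟩ := QuotientGroup.mk_surjective t
  have hle : holomorph (G p m n r) ≤ multipleHolomorph (G p m n r) := Subgroup.le_normalizer
  -- Chosen so that π ρ(s) fixes 1; the coset modulo Hol(G) is unchanged.
  set s : G p m n r := ((π : Equiv.Perm (G p m n r))⁻¹ 1)⁻¹
  have h1 : ((π : Equiv.Perm (G p m n r)) * rho s) 1 = 1 := by
    rw [Equiv.Perm.mul_apply, rho_apply, one_mul, inv_inv, perm_apply_inv_self]
  obtain ⟨l, hl, φ, hφ⟩ := exists_powerMap_comp_aut h hr hn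
    (mul_mem π.2 (hle (rho_mem_holomorph s))) h1
  obtain ⟨f, -, -, hf, -⟩ := exists_powerPerm (n := n) h hr hl
  refine ⟨l, hl, ⟨f, powerPerm_mem_multipleHolomorph h hr hl hf⟩, funext hf, ?_⟩
  rw [QuotientGroup.eq, Subgroup.mem_subgroupOf]
  have h2 : (π : Equiv.Perm (G p m n r)) * rho s = f * autPerm φ := by
    ext σ
    rw [hφ, Equiv.Perm.mul_apply f, hf, autPerm_apply]
  have h3 : (π : Equiv.Perm (G p m n r))⁻¹ * f = rho s * (autPerm φ)⁻¹ := by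
    rw [inv_mul_eq_iff_eq_mul, ← mul_assoc, h2, mul_inv_cancel_right]
  change (π : Equiv.Perm (G p m n r))⁻¹ * f ∈ _
  rw [h3]
  exact mul_mem (rho_mem_holomorph s) (inv_mem (autPerm_mem_holomorph φ))

end Classification

end SplitMetacyclic

theorem mainTheorem6 (p m n r : ℕ) (h : SplitMetacyclic.Params p m n r)
    (u : (ZMod (p ^ m))ˣ) (hu : ∀ z : (ZMod (p ^ m))ˣ, z ∈ Subgroup.zpowers u)
    (hcase : (m ≤ n ∧ r ≤ m - r) ∨ n ≤ m - r) :
    (SplitMetacyclic.admissibleClasses h u).ncard = (p - 1) * p ^ (r - 1) ∧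
    (∀ a b : ℤ, SplitMetacyclic.Admissible h u a b 0 → SplitMetacyclic.IsoCriterion h u a b →
      (∃ j : ℕ, SplitMetacyclic.IsExponent p m r u a b j) ∧
      ∀ j : ℕ, SplitMetacyclic.IsExponent p m r u a b j →
        (∃! π : Equiv.Perm (SplitMetacyclic.G p m n r), SplitMetacyclic.IsPi h u a b 0 j π) ∧
        ∀ π : Equiv.Perm (SplitMetacyclic.G p m n r), SplitMetacyclic.IsPi h u a b 0 j π →
          SplitMetacyclic.EqModAut π
            (SplitMetacyclic.powerMap (SplitMetacyclic.G p m n r) (-(j : ℤ)))) ∧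
    (n ≤ m - r →
      (∀ l : ℤ, IsCoprime l (p : ℤ) →
        ∃ τ : SplitMetacyclic.multipleHolomorph (SplitMetacyclic.G p m n r),
          ⇑(τ : Equiv.Perm (SplitMetacyclic.G p m n r)) =
            SplitMetacyclic.powerMap (SplitMetacyclic.G p m n r) l) ∧
      ∀ t : SplitMetacyclic.T (SplitMetacyclic.G p m n r),
        ∃ l : ℤ, IsCoprime l (p : ℤ) ∧
          ∃ τ : SplitMetacyclic.multipleHolomorph (SplitMetacyclic.G p m n r),
            ⇑(τ : Equiv.Perm (SplitMetacyclic.G p m n r)) =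
              SplitMetacyclic.powerMap (SplitMetacyclic.G p m n r) l ∧
            t = QuotientGroup.mk τ) := by
  open SplitMetacyclic in
  -- In the second case this follows from r ≤ n ≤ m - r.
  have hr : r ≤ m - r := by
    have := h.r_le_n
    omega
  have hcase' : m ≤ n ∨ n ≤ m - r := hcase.imp_left And.left
  refine ⟨ncard_admissibleClasses h hr hcase' hu, fun a b hab hiso => ?_, fun hn => ⟨fun l hl => ?_,
    exists_powerMap_representative h hr hn⟩⟩
  · have hunit := unit_of_admissible h hr u hcase' hab
    exact ⟨exists_isExponent h hr hunit hiso, fun j hj => pi_eqModAut h hr hunit hj⟩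
  · obtain ⟨f, -, -, hf, -⟩ := exists_powerPerm (n := n) h hr hl
    exact ⟨⟨f, powerPerm_mem_multipleHolomorph h hr hl hf⟩, funext hf⟩
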